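/- Let $m\ge 1$ be an integer and let $x_1,\dots,x_m,y,z$ be coordinates on the complex affine space $\mathbb C^{m+2}$. Let $H''_1$ and $H''_2$ be the algebraic hypersurfaces of $\mathbb C^{m+2}$ defined by the equations \[x_1^2\cdots x_m^2\,y+z^2+x_1\cdots x_m\,(z^2-1)=1\] and \[x_1^2\cdots x_m^2\,y+z^2+x_1\cdots x_m\,(z^2-1)^2=1,\] respectively. Then $H''_1$ and $H''_2$ are smooth irreducible algebraic varieties over $\mathbb C$, they are isomorphic as algebraic varieties over $\mathbb C$, and their complements $\mathbb C^{m+2}\setminus H''_1$ and $\mathbb C^{m+2}\setminus H''_2$ are isomorphic as algebraic varieties over $\mathbb C$. Nevertheless, no algebraic automorphism of $\mathbb C^{m+2}$ maps $H''_1$ onto $H''_2$. -/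

import Mathlib

open AlgebraicGeometry CategoryTheory

noncomputable section

/-- The base scheme `Spec ℂ`. All varieties are schemes over it, all morphisms are over it. -/
abbrev SpecC : Scheme.{0} := Spec (CommRingCat.of ℂ)

/-- The complex affine space with coordinates indexed by `σ`, as a scheme over `ℂ`. -/
def affineSpaceC (σ : Type) : Over SpecC :=
  Over.mk (Spec.map (CommRingCat.ofHom (algebraMap ℂ (MvPolynomial σ ℂ))))

/-- The hypersurface `f = 0`, as an abstract scheme over `ℂ`. -/
def hypersurface {σ : Type} (f : MvPolynomial σ ℂ) : Over SpecC :=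
  Over.mk (Spec.map (CommRingCat.ofHom
    (algebraMap ℂ (MvPolynomial σ ℂ ⧸ Ideal.span {f}))))

/-- The underlying closed subset of the hypersurface `f = 0` in affine space. -/
def zeroSet {σ : Type} (f : MvPolynomial σ ℂ) : Set ((affineSpaceC σ).left : Type) :=
  PrimeSpectrum.zeroLocus {f}

theorem isClosed_zeroSet {σ : Type} (f : MvPolynomial σ ℂ) : IsClosed (zeroSet f) :=
  PrimeSpectrum.isClosed_zeroLocus {f}

/-- The inclusion of the hypersurface `f = 0` into affine space. -/
def hypersurfaceIncl {σ : Type} (f : MvPolynomial σ ℂ) : hypersurface f ⟶ affineSpaceC σ :=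
  Over.homMk (Spec.map (CommRingCat.ofHom (Ideal.Quotient.mk (Ideal.span {f})))) (by
    simp only [hypersurface, affineSpaceC, Over.mk_hom]
    exact (Spec.map_comp _ _).symm)

/-- The hypersurface `f = 0` is embedded in affine space as a closed subscheme. -/
theorem isClosedImmersion_hypersurfaceIncl {σ : Type} (f : MvPolynomial σ ℂ) :
    IsClosedImmersion (hypersurfaceIncl f).left :=
  IsClosedImmersion.spec_of_surjective _ Ideal.Quotient.mk_surjective

/-- The image of the embedding is the zero set of `f`. -/
theorem range_hypersurfaceIncl {σ : Type} (f : MvPolynomial σ ℂ) :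
    Set.range (hypersurfaceIncl f).left = zeroSet f := by
  have h := range_comap_of_surjective _
    (Ideal.Quotient.mk (Ideal.span {f})) Ideal.Quotient.mk_surjective
  rw [Ideal.mk_ker, PrimeSpectrum.zeroLocus_span] at h
  exact h

/-- The complement of the hypersurface `f = 0` in affine space: the open subscheme on the
complement of the zero set, as a scheme over `ℂ`. -/
def hypersurfaceComplement {σ : Type} (f : MvPolynomial σ ℂ) : Over SpecC :=
  Over.mk (Scheme.Opens.ι
    (⟨(zeroSet f)ᶜ, (isClosed_zeroSet f).isOpen_compl⟩ : (affineSpaceC σ).left.Opens) ≫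
      (affineSpaceC σ).hom)

/-- The polynomial `x₁² ⋯ xₘ² y + z² + x₁ ⋯ xₘ (z² - 1)ᵏ - 1`. The coordinates of the affine
space of dimension `m + 2` are `xᵢ = X (inl i)`, `y = X (inr 0)` and `z = X (inr 1)`. -/
def hPoly (m k : ℕ) : MvPolynomial (Fin m ⊕ Fin 2) ℂ :=
  (∏ i : Fin m, MvPolynomial.X (Sum.inl i) ^ 2) * MvPolynomial.X (Sum.inr 0)
    + MvPolynomial.X (Sum.inr 1) ^ 2
    + (∏ i : Fin m, MvPolynomial.X (Sum.inl i)) * (MvPolynomial.X (Sum.inr 1) ^ 2 - 1) ^ k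
    - 1

end

/-!
Write `u = x₁ ⋯ xₘ`, `s = z² - 1` and `P_k = hPoly m k = u² y + s + u sᵏ`.

*The positive statements.* Modulo `P_(k+1) = 0`, multiplication by `1 - u sᵏ` removes the term of
order one in `u`, so both hypersurfaces are isomorphic to `u² y + s = 0`
(`nonempty_algEquiv_hPoly`), which is smooth by the infinitesimal lifting criterion. They are
irreducible because `P_k` is linear in `y` with coprime coefficients. On the complement of
`P₂ = t ≠ 0` one has `s ≡ t` modulo `u`, so that multiplying one of the `xᵢ` by `t` exchanges the
terms `u s` and `u s²` up to a change of `y` (`nonempty_algEquiv_localization`).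

*The negative statement.* An automorphism of affine space mapping one hypersurface onto the other
gives an automorphism `φ` of `ℂ[x, y, z]` with `φ(P₁) = c P₂`. The derivation
`Δ_k = u² ∂/∂z - (∂P_k/∂z) ∂/∂y` is locally nilpotent and kills the `xᵢ` and `P_k`. Let `D` be the
transport of `Δ₁` along `φ`; it is locally nilpotent and kills `P₂`.

The first step is `D(xᵢ) = 0` (`apply_X_eq_zero`). Give `xᵢ` the weight `-1`, `y` the weight `2` and
all other coordinates the weight `0`. The leading part `E` of `D` is again a nonzero locally
nilpotent derivation, and it kills the leading part `u² y + z² - 1` of `P₂`. If `D` killed an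
element of positive weight, then `E` would kill its leading part, which is divisible by `y`; hence
`E(y) = 0`, as kernels of locally nilpotent derivations are factorially closed, and
`y u E(u) = - z E(z)`. Then `z ∣ E(u)` and `u ∣ E(z)`, which is impossible for reasons of degree
unless `E = 0` (`eq_zero_of_leading`). So the kernel of `D` has weights at most `0`, and its
reduction modulo `xᵢ` does not involve `y`. Since the kernel contains a polynomial ring in `m + 1`
variables while only `m` coordinates are left, some nonzero element of the kernel is divisible by
`xᵢ`, and factorial closedness gives `D(xᵢ) = 0`.

It follows that `D = h Δ₂` (`exists_conj_eq_smul`). The reflection `z ↦ -z` shows that the elements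
of the kernel of `Δ₂` are even in `z`, and that kernel elements in the image of `Δ₂` are divisible
by `u²` (`xProd_sq_dvd_of_stdDerivation`). Applied to `φ(u)² = D(φ(z))`, this gives `u ∣ φ(u)`, and
by symmetry `φ(u) = a u` with a constant `a` (`exists_apply_xProd_eq`).

Finally, comparing the terms of order at most one in `xᵢ` in `φ(P₁) = c P₂` forces
`φ(z) = ± z (1 + u s / 2)` modulo `xᵢ²`. Substituted into `D(φ(z)) = a² u²` this shows that
`1 - u / 2` would be a unit modulo `xᵢ²` in the ring of polynomials without `z`, a contradiction
(`not_apply_hPoly_eq`).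
-/

/-! ### Locally nilpotent derivations -/

section LocallyNilpotent

variable {R A : Type*} [CommRing R] [CommRing A] [Algebra R A]

/-- A derivation is locally nilpotent if every element is killed by some iterate of it. -/
def Derivation.IsLocallyNilpotent (D : Derivation R A A) : Prop :=
  ∀ a, ∃ n, D^[n] a = 0

namespace Derivation

variable (D : Derivation R A A)

theorem iterate_mul (n : ℕ) (a b : A) :
    D^[n] (a * b) =
      ∑ p ∈ Finset.HasAntidiagonal.antidiagonal n,
        (n.choose p.1 : A) * (D^[p.1] a * D^[p.2] b) := by
  induction n with
  | zero => simp
  | succ n ih =>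
    rw [Finset.sum_antidiagonal_choose_succ_mul (fun i j => D^[i] a * D^[j] b),
      Function.iterate_succ_apply', ih, map_sum, ← Finset.sum_add_distrib]
    refine Finset.sum_congr rfl fun p hp => ?_
    rw [Nat.choose_symm_of_eq_add (Finset.HasAntidiagonal.mem_antidiagonal.1 hp).symm]
    simp only [leibniz, Function.iterate_succ_apply', smul_eq_mul, map_natCast]
    ring

theorem iterate_eq_zero_of_le {a : A} {n k : ℕ} (h : D^[n] a = 0) (hk : n ≤ k) :
    D^[k] a = 0 := by
  obtain ⟨j, rfl⟩ := Nat.exists_eq_add_of_le' hk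
  rw [Function.iterate_add_apply, h, iterate_map_zero]

/-- The elements killed by some iterate of `D`. -/
def nilSubalgebra : Subalgebra R A where
  carrier := {a | ∃ n, D^[n] a = 0}
  add_mem' := by
    rintro a b ⟨n, hn⟩ ⟨k, hk⟩
    refine ⟨n + k, ?_⟩
    rw [iterate_map_add, D.iterate_eq_zero_of_le hn (by omega),
      D.iterate_eq_zero_of_le hk (by omega), add_zero]
  mul_mem' := by
    rintro a b ⟨n, hn⟩ ⟨k, hk⟩
    refine ⟨n + k, ?_⟩
    rw [iterate_mul]
    refine Finset.sum_eq_zero fun p hp => ?_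
    rw [Finset.HasAntidiagonal.mem_antidiagonal] at hp
    rcases le_or_gt n p.1 with h | h
    · rw [D.iterate_eq_zero_of_le hn h, zero_mul, mul_zero]
    · rw [D.iterate_eq_zero_of_le hk (k := p.2) (by omega), mul_zero, mul_zero]
  algebraMap_mem' r := ⟨1, D.map_algebraMap r⟩

theorem mem_nilSubalgebra {a : A} : a ∈ D.nilSubalgebra ↔ ∃ n, D^[n] a = 0 := Iff.rfl

theorem mem_nilSubalgebra_of_apply_mem {a : A} (h : D a ∈ D.nilSubalgebra) :
    a ∈ D.nilSubalgebra := by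
  obtain ⟨n, hn⟩ := h
  exact ⟨n + 1, hn⟩

variable {D}

theorem exists_last_iterate {a : A} (ha : a ≠ 0) (h : ∃ n, D^[n] a = 0) :
    ∃ n, D^[n] a ≠ 0 ∧ D^[n + 1] a = 0 := by
  classical
  have h0 : Nat.find h ≠ 0 := fun h0 => ha (by simpa [h0] using Nat.find_spec h)
  obtain ⟨n, hn⟩ := Nat.exists_eq_succ_of_ne_zero h0
  exact ⟨n, Nat.find_min h (by omega), by simpa [hn] using Nat.find_spec h⟩

/-- The degree with respect to a locally nilpotent derivation is additive, so a divisor of a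
nonzero element dies at least as early as the element itself. The case `n = 1` says that the
kernel is factorially closed. -/
theorem IsLocallyNilpotent.iterate_eq_zero_of_dvd [IsDomain A] [CharZero A]
    (hD : D.IsLocallyNilpotent) {a c : A} (hac : a ∣ c) (hc : c ≠ 0) {n : ℕ}
    (h : D^[n] c = 0) : D^[n] a = 0 := by
  obtain ⟨b, rfl⟩ := hac
  obtain ⟨i, hi, hi'⟩ := exists_last_iterate (left_ne_zero_of_mul hc) (hD a)
  obtain ⟨j, hj, hj'⟩ := exists_last_iterate (right_ne_zero_of_mul hc) (hD b)
  have key : D^[i + j] (a * b) = ((i + j).choose i : A) * (D^[i] a * D^[j] b) := by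
    rw [iterate_mul, Finset.sum_eq_single (i, j)]
    · intro p hp hne
      rw [Finset.HasAntidiagonal.mem_antidiagonal] at hp
      rcases lt_trichotomy p.1 i with hlt | heq | hgt
      · rw [D.iterate_eq_zero_of_le hj' (k := p.2) (by omega), mul_zero, mul_zero]
      · exact absurd (Prod.ext heq (by simp only; omega)) hne
      · rw [D.iterate_eq_zero_of_le hi' (k := p.1) (by omega), zero_mul, mul_zero]
    · intro hn
      exact absurd (by simp) hn
  have hne : D^[i + j] (a * b) ≠ 0 := by
    rw [key]
    exact mul_ne_zero (Nat.cast_ne_zero.2 (Nat.choose_pos (by omega)).ne') (mul_ne_zero hi hj)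
  by_contra hna
  have h1 : ¬ i < n := fun hlt => hna (D.iterate_eq_zero_of_le hi' hlt)
  exact hne (D.iterate_eq_zero_of_le h (by omega))

theorem IsLocallyNilpotent.eq_zero_of_dvd [IsDomain A] [CharZero A]
    (hD : D.IsLocallyNilpotent) {a c : A} (hac : a ∣ c) (hc : c ≠ 0) (h : D c = 0) :
    D a = 0 :=
  hD.iterate_eq_zero_of_dvd (n := 1) hac hc h

/-- A locally nilpotent derivation lowers the degree by one, hence the images of two elements
cannot be nonzero multiples of one another crosswise. -/
theorem IsLocallyNilpotent.eq_zero_or_eq_zero_of_dvd_of_dvd [IsDomain A] [CharZero A]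
    (hD : D.IsLocallyNilpotent) {a b : A} (hab : a ∣ D b) (hba : b ∣ D a) :
    D a = 0 ∨ D b = 0 := by
  by_contra! h
  have ha : a ≠ 0 := fun h0 => h.1 (by rw [h0, map_zero])
  have hb : b ≠ 0 := fun h0 => h.2 (by rw [h0, map_zero])
  obtain ⟨n, hn, hn'⟩ := exists_last_iterate ha (hD a)
  have h1 : D^[n] b = 0 := hD.iterate_eq_zero_of_dvd hba h.1 hn'
  cases n with
  | zero => exact hb h1
  | succ n =>
    have h2 : D^[n] a = 0 := hD.iterate_eq_zero_of_dvd hab h.2 h1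
    exact hn (D.iterate_eq_zero_of_le h2 (by omega))

end Derivation

end LocallyNilpotent

/-! ### Leading parts of derivations of polynomial rings -/

section LeadingPart

namespace MvPolynomial

variable {R σ : Type*} [CommRing R] (w : σ → ℤ)

/-- All monomials of `f` have weight at most `e`. The weights may be negative. -/
def WeightLE (e : ℤ) (f : MvPolynomial σ R) : Prop :=
  ∀ n, e < Finsupp.weight w n → coeff n f = 0

variable {w}

theorem WeightLE.mono {e e' : ℤ} {f : MvPolynomial σ R} (h : WeightLE w e f) (he : e ≤ e') :
    WeightLE w e' f := fun n hn => h n (he.trans_lt hn)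

theorem WeightLE.add {e : ℤ} {f g : MvPolynomial σ R} (hf : WeightLE w e f)
    (hg : WeightLE w e g) : WeightLE w e (f + g) := fun n hn => by
  rw [coeff_add, hf n hn, hg n hn, add_zero]

theorem WeightLE.mul {e e' : ℤ} {f g : MvPolynomial σ R} (hf : WeightLE w e f)
    (hg : WeightLE w e' g) : WeightLE w (e + e') (f * g) := fun n hn => by
  classical
  rw [coeff_mul]
  refine Finset.sum_eq_zero fun p hp => ?_
  rw [Finset.HasAntidiagonal.mem_antidiagonal] at hp
  rw [← hp, map_add] at hn
  rcases lt_or_ge e (Finsupp.weight w p.1) with h | h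
  · rw [hf _ h, zero_mul]
  · rw [hg p.2 (by omega), mul_zero]

theorem IsWeightedHomogeneous.weightLE {e : ℤ} {f : MvPolynomial σ R}
    (hf : IsWeightedHomogeneous w f e) : WeightLE w e f := fun n hn => by
  by_contra h
  exact hn.ne' (hf h)

theorem WeightLE.component_eq_zero {e e' : ℤ} {f : MvPolynomial σ R} (hf : WeightLE w e f)
    (he : e < e') : weightedHomogeneousComponent w e' f = 0 := by
  classical
  ext n
  rw [coeff_weightedHomogeneousComponent, coeff_zero]
  split_ifs with h
  · exact hf n (h ▸ he)
  · rfl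

theorem WeightLE.component_mul {e e' : ℤ} {f g : MvPolynomial σ R} (hf : WeightLE w e f)
    (hg : WeightLE w e' g) :
    weightedHomogeneousComponent w (e + e') (f * g) =
      weightedHomogeneousComponent w e f * weightedHomogeneousComponent w e' g := by
  classical
  ext n
  rw [coeff_weightedHomogeneousComponent, coeff_mul, coeff_mul]
  simp only [coeff_weightedHomogeneousComponent]
  split_ifs with h
  · refine Finset.sum_congr rfl fun p hp => ?_
    rw [Finset.HasAntidiagonal.mem_antidiagonal] at hp
    rw [← hp, map_add] at h
    by_cases h1 : Finsupp.weight w p.1 = e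
    · rw [if_pos h1, if_pos (by omega)]
    · rw [if_neg h1, zero_mul]
      rcases lt_or_gt_of_ne h1 with h2 | h2
      · rw [hg p.2 (by omega), mul_zero]
      · rw [hf p.1 h2, zero_mul]
  · refine (Finset.sum_eq_zero fun p hp => ?_).symm
    rw [Finset.HasAntidiagonal.mem_antidiagonal] at hp
    rw [← hp, map_add] at h
    by_cases h1 : Finsupp.weight w p.1 = e
    · rw [if_neg (c := Finsupp.weight w p.2 = e') (by omega), mul_zero]
    · rw [if_neg h1, zero_mul]

variable (w) in
/-- The part of degree `d` of a derivation: it raises weights by exactly `d`. -/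
noncomputable def weightedPart (D : Derivation R (MvPolynomial σ R) (MvPolynomial σ R)) (d : ℤ) :
    Derivation R (MvPolynomial σ R) (MvPolynomial σ R) :=
  mkDerivation R fun s => weightedHomogeneousComponent w (w s + d) (D (X s))

/-- If `D` raises the weights of the variables by at most `d`, then it raises all weights by at
most `d`, and the part of degree `d` of `D` computes the leading components. -/
theorem WeightLE.derivation {D : Derivation R (MvPolynomial σ R) (MvPolynomial σ R)} {d : ℤ}
    (hD : ∀ s, WeightLE w (w s + d) (D (X s))) {e : ℤ} {f : MvPolynomial σ R}
    (hf : WeightLE w e f) :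
    WeightLE w (e + d) (D f) ∧ weightedHomogeneousComponent w (e + d) (D f) =
      weightedPart w D d (weightedHomogeneousComponent w e f) := by
  classical
  let P : ℤ → MvPolynomial σ R → Prop := fun e f => WeightLE w e f ∧ WeightLE w (e + d) (D f) ∧
    weightedHomogeneousComponent w (e + d) (D f) =
      weightedPart w D d (weightedHomogeneousComponent w e f)
  have hadd : ∀ e f g, P e f → P e g → P e (f + g) := by
    rintro e f g ⟨h1, h2, h3⟩ ⟨h1', h2', h3'⟩
    refine ⟨h1.add h1', ?_, ?_⟩
    · rw [map_add]
      exact h2.add h2'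
    · simp only [map_add, h3, h3']
  have hmul : ∀ e e' f g, P e f → P e' g → P (e + e') (f * g) := by
    rintro e e' f g ⟨h1, h2, h3⟩ ⟨h1', h2', h3'⟩
    have a1 := h1.mul h2'
    have a2 := h1'.mul h2
    have b1 := h1.component_mul h2'
    have b2 := h1'.component_mul h2
    rw [show e + (e' + d) = e + e' + d by ring] at a1 b1
    rw [show e' + (e + d) = e + e' + d by ring] at a2 b2
    refine ⟨h1.mul h1', ?_, ?_⟩
    · rw [Derivation.leibniz]
      exact a1.add a2
    · rw [Derivation.leibniz, map_add, smul_eq_mul, smul_eq_mul, b1, b2, h3, h3',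
        h1.component_mul h1', Derivation.leibniz, smul_eq_mul, smul_eq_mul]
  have hmono : ∀ e e' f, e ≤ e' → P e f → P e' f := by
    rintro e e' f he h
    rcases he.eq_or_lt with rfl | he
    · exact h
    refine ⟨h.1.mono he.le, h.2.1.mono (by omega), ?_⟩
    rw [h.2.1.component_eq_zero (by omega), h.1.component_eq_zero he, map_zero]
  have hC : ∀ r, P 0 (C r) := fun r => by
    have hr : D (C r) = 0 := D.map_algebraMap r
    refine ⟨(isWeightedHomogeneous_C w r).weightLE, ?_, ?_⟩
    · rw [hr]
      exact fun _ _ => coeff_zero _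
    · rw [hr, map_zero,
        (isWeightedHomogeneous_C w r).weightedHomogeneousComponent_same]
      exact ((weightedPart w D d).map_algebraMap r).symm
  have hX : ∀ s, P (w s) (X s) := fun s => by
    refine ⟨(isWeightedHomogeneous_X R w s).weightLE, hD s, ?_⟩
    rw [(isWeightedHomogeneous_X R w s).weightedHomogeneousComponent_same, weightedPart,
      mkDerivation_X]
  have hpow : ∀ s (k : ℕ), P (k * w s) (X s ^ k) := by
    intro s k
    induction k with
    | zero => simpa using hC 1
    | succ k ih =>
      have := hmul _ _ _ _ ih (hX s)
      rw [pow_succ]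
      convert this using 1
      push_cast
      ring
  have hmon : ∀ (n : σ →₀ ℕ) (r : R), P (Finsupp.weight w n) (monomial n r) := by
    intro n
    induction n using Finsupp.induction with
    | zero => intro r; simpa using hC r
    | single_add s k n _ _ ih =>
      intro r
      have := hmul _ _ _ _ (hpow s k) (ih r)
      rw [X_pow_eq_monomial, monomial_mul, one_mul] at this
      rw [map_add, Finsupp.weight_single]
      simpa using this
  refine (show P e f from ?_).2
  rw [f.as_sum]
  have hsum : ∀ S : Finset (σ →₀ ℕ), S ⊆ f.support → P e (∑ n ∈ S, monomial n (coeff n f)) := by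
    intro S
    induction S using Finset.induction_on with
    | empty =>
      intro _
      refine ⟨fun _ _ => ?_, fun _ _ => ?_, ?_⟩ <;> simp
    | insert n S hn ih =>
      intro hS
      rw [Finset.sum_insert hn]
      refine hadd _ _ _ (hmono _ _ _ ?_ (hmon n _)) (ih fun _ h => hS (Finset.mem_insert_of_mem h))
      by_contra! h
      exact mem_support_iff.1 (hS (Finset.mem_insert_self _ _)) (hf n h)
  exact hsum _ subset_rfl

theorem isLocallyNilpotent_of_forall_X {D : Derivation R (MvPolynomial σ R) (MvPolynomial σ R)}
    (h : ∀ s, X s ∈ D.nilSubalgebra) : D.IsLocallyNilpotent := by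
  have htop : D.nilSubalgebra = ⊤ := by
    rw [eq_top_iff, ← adjoin_range_X, Algebra.adjoin_le_iff]
    rintro _ ⟨s, rfl⟩
    exact h s
  intro a
  exact D.mem_nilSubalgebra.1 (htop ▸ Algebra.mem_top)

/-- For every integral weight, the leading part of a nonzero locally nilpotent derivation of a
polynomial ring is again nonzero and locally nilpotent. -/
theorem exists_leading_derivation [Finite σ]
    {D : Derivation R (MvPolynomial σ R) (MvPolynomial σ R)} (hD : D.IsLocallyNilpotent)
    (hD0 : D ≠ 0) (w : σ → ℤ) :
    ∃ (d : ℤ) (E : Derivation R (MvPolynomial σ R) (MvPolynomial σ R)),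
      E.IsLocallyNilpotent ∧ E ≠ 0 ∧ ∀ (e : ℤ) (f : MvPolynomial σ R), WeightLE w e f →
        weightedHomogeneousComponent w (e + d) (D f) =
          E (weightedHomogeneousComponent w e f) := by
  classical
  have := Fintype.ofFinite σ
  let S : Finset ℤ := Finset.univ.biUnion fun s : σ =>
    (D (X s)).support.image fun n => Finsupp.weight w n - w s
  have hS : S.Nonempty := by
    obtain ⟨s, hs⟩ : ∃ s, D (X s) ≠ 0 := by
      by_contra! h
      exact hD0 (derivation_ext h)
    obtain ⟨n, hn⟩ := support_nonempty.2 hs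
    exact ⟨_, Finset.mem_biUnion.2 ⟨s, Finset.mem_univ s, Finset.mem_image_of_mem _ hn⟩⟩
  let d := S.max' hS
  have hle : ∀ s, WeightLE w (w s + d) (D (X s)) := by
    intro s n hn
    by_contra h
    have : Finsupp.weight w n - w s ≤ d := S.le_max' _ (Finset.mem_biUnion.2
      ⟨s, Finset.mem_univ s, Finset.mem_image_of_mem _ (mem_support_iff.2 h)⟩)
    omega
  have hlead : ∀ (e : ℤ) (f : MvPolynomial σ R), WeightLE w e f → ∀ n : ℕ,
      WeightLE w (e + n * d) (D^[n] f) ∧ weightedHomogeneousComponent w (e + n * d) (D^[n] f) =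
        (weightedPart w D d)^[n] (weightedHomogeneousComponent w e f) := by
    intro e f hf n
    induction n with
    | zero => simpa using hf
    | succ n ih =>
      have := WeightLE.derivation hle ih.1
      rw [show e + ((n + 1 : ℕ) : ℤ) * d = e + n * d + d by push_cast; ring,
        Function.iterate_succ_apply', Function.iterate_succ_apply', ← ih.2]
      exact this
  refine ⟨d, weightedPart w D d, isLocallyNilpotent_of_forall_X fun s => ?_, ?_,
    fun e f hf => (WeightLE.derivation hle hf).2⟩
  · obtain ⟨n, hn⟩ := hD (X s)
    refine ⟨n, ?_⟩
    have := (hlead _ _ (isWeightedHomogeneous_X R w s).weightLE n).2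
    rwa [hn, map_zero, (isWeightedHomogeneous_X R w s).weightedHomogeneousComponent_same,
      eq_comm] at this
  · intro h0
    obtain ⟨s, -, hs⟩ := Finset.mem_biUnion.1 (S.max'_mem hS)
    obtain ⟨n, hn, hnd⟩ := Finset.mem_image.1 hs
    have h1 : weightedPart w D d (X s) = 0 := by rw [h0, Derivation.zero_apply]
    rw [weightedPart, mkDerivation_X] at h1
    have h2 := congrArg (coeff n) h1
    rw [coeff_weightedHomogeneousComponent, if_pos (by change _ = d at hnd; omega),
      coeff_zero] at h2
    exact mem_support_iff.1 hn h2

end MvPolynomial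

end LeadingPart

/-! ### The coordinates and the polynomials `hPoly m k` -/

section Coordinates

open MvPolynomial

variable {m : ℕ}

/-- The product `u = x₁ ⋯ xₘ`. -/
noncomputable abbrev xProd (m : ℕ) : MvPolynomial (Fin m ⊕ Fin 2) ℂ := ∏ i : Fin m, X (Sum.inl i)

/-- The coordinate `y`. -/
noncomputable abbrev yCoord (m : ℕ) : MvPolynomial (Fin m ⊕ Fin 2) ℂ := X (Sum.inr 0)

/-- The coordinate `z`. -/
noncomputable abbrev zCoord (m : ℕ) : MvPolynomial (Fin m ⊕ Fin 2) ℂ := X (Sum.inr 1)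

theorem hPoly_eq (m k : ℕ) :
    hPoly m k = xProd m ^ 2 * yCoord m + zCoord m ^ 2 + xProd m * (zCoord m ^ 2 - 1) ^ k - 1 := by
  rw [hPoly, Finset.prod_pow]

theorem xProd_ne_zero : xProd m ≠ 0 := Finset.prod_ne_zero_iff.2 fun _ _ => X_ne_zero _

theorem isRelPrime_xProd {f : MvPolynomial (Fin m ⊕ Fin 2) ℂ}
    (hf : ∀ i : Fin m, ¬ X (Sum.inl i) ∣ f) : IsRelPrime (xProd m) f :=
  IsRelPrime.prod_left fun i _ => X_prime.irreducible.isRelPrime_iff_not_dvd.2 (hf i)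

theorem isRelPrime_xProd_zCoord : IsRelPrime (xProd m) (zCoord m) :=
  isRelPrime_xProd fun i h => by simpa using X_dvd_X.1 h

theorem not_zCoord_dvd_xProd : ¬ zCoord m ∣ xProd m := fun h => by
  obtain ⟨i, -, hi⟩ := (Prime.dvd_finsetProd_iff X_prime _).1 h
  simpa using X_dvd_X.1 hi

/-- A polynomial is congruent modulo a variable to its value where that variable vanishes. -/
theorem X_dvd_sub_aeval {σ : Type*} [DecidableEq σ] (s : σ) (f : MvPolynomial σ ℂ) :
    X s ∣ f - aeval (Function.update X s 0) f := by
  induction f using MvPolynomial.induction_on with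
  | C a => simp
  | add p q hp hq =>
    rw [map_add, add_sub_add_comm]
    exact dvd_add hp hq
  | mul_X p t hp =>
    rw [map_mul, aeval_X]
    rcases eq_or_ne t s with rfl | h
    · simp
    · rw [Function.update_of_ne h, ← sub_mul]
      exact hp.mul_right _

/-- The weight for which `xᵢ` has weight `-1`, `y` has weight `2` and all other coordinates have
weight `0`. -/
def coordWeight (i : Fin m) : Fin m ⊕ Fin 2 → ℤ :=
  Sum.elim (fun j => if j = i then -1 else 0) ![2, 0]

theorem isWeightedHomogeneous_xProd (i : Fin m) :
    IsWeightedHomogeneous (coordWeight i) (xProd m) (-1) := by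
  have h := IsWeightedHomogeneous.prod Finset.univ
    (fun j : Fin m => (X (Sum.inl j) : MvPolynomial (Fin m ⊕ Fin 2) ℂ))
    (fun j => coordWeight i (Sum.inl j)) (w := coordWeight i)
    fun j _ => isWeightedHomogeneous_X ℂ _ _
  have hs : ∑ j : Fin m, coordWeight i (Sum.inl j) = -1 := by simp [coordWeight]
  rwa [hs] at h

theorem isWeightedHomogeneous_sq_mul_add_sq (i : Fin m) :
    IsWeightedHomogeneous (coordWeight i) (xProd m ^ 2 * yCoord m + zCoord m ^ 2 - 1) 0 := by
  refine ((?_ : IsWeightedHomogeneous _ _ _).add ?_).sub (isWeightedHomogeneous_one ℂ _)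
  · exact ((isWeightedHomogeneous_xProd i).pow 2).mul (isWeightedHomogeneous_X ℂ _ (Sum.inr 0))
  · exact (isWeightedHomogeneous_X ℂ (coordWeight i) (Sum.inr 1)).pow 2

theorem isWeightedHomogeneous_xProd_mul (i : Fin m) (k : ℕ) :
    IsWeightedHomogeneous (coordWeight i) (xProd m * (zCoord m ^ 2 - 1) ^ k) (-1) := by
  have h1 : IsWeightedHomogeneous (coordWeight i) (zCoord m ^ 2 - 1) 0 :=
    ((isWeightedHomogeneous_X ℂ (coordWeight i) (Sum.inr 1)).pow 2).sub
      (isWeightedHomogeneous_one ℂ _)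
  simpa using (isWeightedHomogeneous_xProd i).mul (h1.pow k)

theorem hPoly_eq_add (m k : ℕ) : hPoly m k = (xProd m ^ 2 * yCoord m + zCoord m ^ 2 - 1) +
    xProd m * (zCoord m ^ 2 - 1) ^ k := by
  rw [hPoly_eq]
  ring

theorem weightLE_hPoly (i : Fin m) (k : ℕ) : WeightLE (coordWeight i) 0 (hPoly m k) := by
  rw [hPoly_eq_add]
  exact (isWeightedHomogeneous_sq_mul_add_sq i).weightLE.add
    ((isWeightedHomogeneous_xProd_mul i k).weightLE.mono (by norm_num))

theorem component_hPoly (i : Fin m) (k : ℕ) :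
    weightedHomogeneousComponent (coordWeight i) 0 (hPoly m k) =
      xProd m ^ 2 * yCoord m + zCoord m ^ 2 - 1 := by
  rw [hPoly_eq_add, map_add,
    (isWeightedHomogeneous_sq_mul_add_sq i).weightedHomogeneousComponent_same,
    (isWeightedHomogeneous_xProd_mul i k).weightedHomogeneousComponent_ne _ (by norm_num),
    add_zero]

/-! ### Locally nilpotent derivations annihilating `hPoly m k` -/

/-- A locally nilpotent derivation that kills `y` and the leading part of `hPoly m k` vanishes:
`y u E(u) = - z E(z)`, so that `u ∣ E(z)` and `z ∣ E(u)`. -/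
theorem eq_zero_of_leading {E : Derivation ℂ (MvPolynomial (Fin m ⊕ Fin 2) ℂ) _}
    (hE : E.IsLocallyNilpotent) (hy : E (yCoord m) = 0)
    (hP : E (xProd m ^ 2 * yCoord m + zCoord m ^ 2 - 1) = 0) : E = 0 := by
  have h1 : yCoord m * (xProd m * E (xProd m)) = - (zCoord m * E (zCoord m)) := by
    rw [map_sub, map_add, Derivation.leibniz, hy, Derivation.leibniz_pow, Derivation.leibniz_pow,
      E.map_one_eq_zero] at hP
    simp only [smul_eq_mul, nsmul_eq_mul, mul_zero, zero_add, sub_zero, Nat.cast_ofNat,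
      Nat.add_one_sub_one, pow_one] at hP
    have h2 : (2 : MvPolynomial (Fin m ⊕ Fin 2) ℂ) ≠ 0 := two_ne_zero
    refine mul_left_cancel₀ h2 ?_
    linear_combination hP
  have hz : zCoord m ∣ E (xProd m) := by
    have h2 : zCoord m ∣ yCoord m * (xProd m * E (xProd m)) :=
      h1 ▸ (dvd_neg.2 (dvd_mul_right _ _))
    rcases X_prime.dvd_or_dvd h2 with h | h
    · simpa using X_dvd_X.1 h
    · exact (X_prime.dvd_or_dvd h).resolve_left not_zCoord_dvd_xProd
  have hu : xProd m ∣ E (zCoord m) := by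
    refine isRelPrime_xProd_zCoord.dvd_of_dvd_mul_left ?_
    rw [← dvd_neg, ← h1]
    exact (dvd_mul_right _ _).mul_left _
  have hboth : E (xProd m) = 0 ∧ E (zCoord m) = 0 := by
    rcases hE.eq_zero_or_eq_zero_of_dvd_of_dvd hu hz with h | h
    · rw [h, mul_zero, mul_zero, zero_eq_neg, mul_eq_zero] at h1
      exact ⟨h, h1.resolve_left (X_ne_zero _)⟩
    · rw [h, mul_zero, neg_zero, mul_eq_zero, mul_eq_zero] at h1
      exact ⟨(h1.resolve_left (X_ne_zero _)).resolve_left xProd_ne_zero, h⟩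
  refine derivation_ext fun s => ?_
  rw [Derivation.zero_apply]
  rcases s with i | s
  · exact hE.eq_zero_of_dvd (Finset.dvd_prod_of_mem (fun j => X (Sum.inl j)) (Finset.mem_univ i))
      xProd_ne_zero hboth.1
  · fin_cases s
    · exact hy
    · exact hboth.2

/-- Every element killed by a nonzero locally nilpotent derivation that annihilates `hPoly m k`
has weight at most `0`; otherwise its leading component is divisible by `y`, and the leading
part of the derivation would vanish. -/
theorem weightLE_zero_of_apply_eq_zero
    {D : Derivation ℂ (MvPolynomial (Fin m ⊕ Fin 2) ℂ) (MvPolynomial (Fin m ⊕ Fin 2) ℂ)}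
    (hD : D.IsLocallyNilpotent) (hD0 : D ≠ 0) {k : ℕ} (hP : D (hPoly m k) = 0) (i : Fin m)
    {f : MvPolynomial (Fin m ⊕ Fin 2) ℂ} (hf : D f = 0) : WeightLE (coordWeight i) 0 f := by
  classical
  obtain ⟨d, E, hE, hE0, hlead⟩ := exists_leading_derivation hD hD0 (coordWeight i)
  by_contra hcon
  simp only [WeightLE, not_forall] at hcon
  obtain ⟨n, hn, hnf⟩ := hcon
  obtain ⟨N, hN, hmax⟩ := f.support.exists_max_image (Finsupp.weight (coordWeight i))
    ⟨n, mem_support_iff.2 hnf⟩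
  have hpos := hn.trans_le (hmax n (mem_support_iff.2 hnf))
  set e := Finsupp.weight (coordWeight i) N with he
  have hfe : WeightLE (coordWeight i) e f := fun p hp => by
    by_contra h
    exact hp.not_ge (hmax p (mem_support_iff.2 h))
  have hne : weightedHomogeneousComponent (coordWeight i) e f ≠ 0 := fun h => by
    have := congrArg (coeff N) h
    rw [coeff_weightedHomogeneousComponent, if_pos he.symm, coeff_zero] at this
    exact mem_support_iff.1 hN this
  have hy : yCoord m ∣ weightedHomogeneousComponent (coordWeight i) e f := by
    rw [weightedHomogeneousComponent_apply]
    refine Finset.dvd_sum fun p hp => ?_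
    rw [Finset.mem_filter] at hp
    refine X_dvd_monomial.2 (Or.inr fun hp0 => ?_)
    have h0 : Finsupp.weight (coordWeight i) p ≤ 0 := by
      rw [Finsupp.weight_apply]
      refine Finset.sum_nonpos fun s _ => ?_
      rcases s with j | s
      · simp only [coordWeight, Sum.elim_inl]
        split_ifs <;> simp
      · fin_cases s <;> simp [coordWeight, hp0]
    omega
  have hEy : E (yCoord m) = 0 := by
    refine hE.eq_zero_of_dvd hy hne ?_
    rw [← hlead e f hfe, hf, map_zero]
  refine hE0 (eq_zero_of_leading hE hEy ?_)
  rw [← component_hPoly i k, ← hlead 0 _ (weightLE_hPoly i k), hP, map_zero]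

/-- The projection to a polynomial ring in `m` variables that sends `xᵢ` and `y` to `0` and puts
`z` in the place of `xᵢ`. -/
noncomputable def specialize (i : Fin m) :
    MvPolynomial (Fin m ⊕ Fin 2) ℂ →ₐ[ℂ] MvPolynomial (Fin m) ℂ :=
  aeval (Sum.elim (Function.update X i 0) ![0, X i])

theorem X_dvd_of_specialize_eq_zero {i : Fin m} {f : MvPolynomial (Fin m ⊕ Fin 2) ℂ}
    (hf : WeightLE (coordWeight i) 0 f) (h : specialize i f = 0) : X (Sum.inl i) ∣ f := by
  classical
  let g : Fin m ⊕ Fin 2 → MvPolynomial (Fin m ⊕ Fin 2) ℂ :=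
    fun s => if s = Sum.inl i ∨ s = Sum.inr 0 then 0 else X s
  let ι : MvPolynomial (Fin m) ℂ →ₐ[ℂ] MvPolynomial (Fin m ⊕ Fin 2) ℂ :=
    aeval (Function.update (fun j => X (Sum.inl j)) i (X (Sum.inr 1)))
  have hι : ι.comp (specialize i) = aeval g := by
    refine algHom_ext fun s => ?_
    rw [AlgHom.comp_apply, specialize, aeval_X, aeval_X]
    rcases s with j | s
    · rcases eq_or_ne j i with rfl | hj
      · simp [g]
      · simp [g, ι, hj]
    · fin_cases s <;> simp [g, ι]
  have hmon : ∀ n ∈ f.support, X (Sum.inl i) ∣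
      monomial n (coeff n f) - aeval g (monomial n (coeff n f)) := by
    intro n hn
    by_cases hi : n (Sum.inl i) = 0
    · have hw : Finsupp.weight (coordWeight i) n = 2 * n (Sum.inr 0) := by
        rw [Finsupp.weight_apply, Finsupp.sum_fintype _ _ (by simp), Fintype.sum_sum_type,
          Finset.sum_eq_zero, Fin.sum_univ_two]
        · simp [coordWeight, mul_comm]
        · intro j _
          rcases eq_or_ne j i with rfl | hj
          · simp [hi]
          · simp [coordWeight, hj]
      have hy : n (Sum.inr 0) = 0 := by
        by_contra hy
        exact mem_support_iff.1 hn (hf n (by omega))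
      have : aeval g (monomial n (coeff n f)) = monomial n (coeff n f) := by
        rw [aeval_monomial, monomial_eq, algebraMap_eq]
        congr 1
        refine Finsupp.prod_congr fun s hs => ?_
        have hs' : ¬ (s = Sum.inl i ∨ s = Sum.inr 0) := by
          rintro (rfl | rfl)
          · exact Finsupp.mem_support_iff.1 hs hi
          · exact Finsupp.mem_support_iff.1 hs hy
        simp only [g, if_neg hs']
      rw [this, sub_self]
      exact dvd_zero _
    · refine dvd_sub (X_dvd_monomial.2 (Or.inr hi)) ?_
      rw [aeval_monomial, Finsupp.prod, Finset.prod_eq_zero (Finsupp.mem_support_iff.2 hi),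
        mul_zero]
      · exact dvd_zero _
      · simp [g, hi]
  have hfg : aeval g f = 0 := by rw [← hι, AlgHom.comp_apply, h, map_zero]
  have hsum := Finset.dvd_sum hmon
  rwa [Finset.sum_sub_distrib, ← map_sum, ← f.as_sum, hfg, sub_zero] at hsum

/-- If the kernel of a nonzero locally nilpotent derivation annihilating `hPoly m k` contains a
polynomial ring in `m + 1` variables, then it contains every `xᵢ`: modulo `xᵢ` the kernel
depends on `m` coordinates only, so some nonzero element of it is divisible by `xᵢ`. -/
theorem apply_X_eq_zero
    {D : Derivation ℂ (MvPolynomial (Fin m ⊕ Fin 2) ℂ) (MvPolynomial (Fin m ⊕ Fin 2) ℂ)}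
    (hD : D.IsLocallyNilpotent) (hD0 : D ≠ 0) {k : ℕ} (hP : D (hPoly m k) = 0)
    (Θ : MvPolynomial (Option (Fin m)) ℂ →ₐ[ℂ] MvPolynomial (Fin m ⊕ Fin 2) ℂ)
    (hΘ : Function.Injective Θ) (hDΘ : ∀ p, D (Θ p) = 0) (i : Fin m) :
    D (X (Sum.inl i)) = 0 := by
  have hni : ¬ Function.Injective ((specialize i).comp Θ) := fun hinj => by
    have h := trdeg_le_of_injective _ hinj
    rw [MvPolynomial.trdeg_of_isDomain, MvPolynomial.trdeg_of_isDomain] at h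
    simp only [Cardinal.mk_fintype, Fintype.card_option, Fintype.card_fin, Cardinal.lift_natCast,
      Nat.cast_le] at h
    omega
  rw [injective_iff_map_eq_zero] at hni
  push Not at hni
  obtain ⟨p, hp, hp0⟩ := hni
  refine hD.eq_zero_of_dvd (X_dvd_of_specialize_eq_zero
    (weightLE_zero_of_apply_eq_zero hD hD0 hP i (hDΘ p)) hp) (fun h => hp0 ?_) (hDΘ p)
  exact hΘ (h.trans (map_zero Θ).symm)

end Coordinates

/-! ### The standard derivation annihilating `hPoly m k` -/

section StandardDerivation

open MvPolynomial

variable {m : ℕ}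

theorem Derivation.apply_prod_eq_zero {R A ι : Type*} [CommRing R] [CommRing A] [Algebra R A]
    (D : Derivation R A A) (s : Finset ι) (f : ι → A) (h : ∀ i ∈ s, D (f i) = 0) :
    D (∏ i ∈ s, f i) = 0 := by
  classical
  induction s using Finset.induction_on with
  | empty => simp
  | insert i s hi ih =>
    rw [Finset.prod_insert hi, leibniz, h i (Finset.mem_insert_self _ _),
      ih fun j hj => h j (Finset.mem_insert_of_mem hj), smul_zero, smul_zero, add_zero]

theorem pderiv_inr_xProd (s : Fin 2) : pderiv (Sum.inr s) (xProd m) = 0 :=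
  Derivation.apply_prod_eq_zero _ _ _ fun i _ => pderiv_X_of_ne (by simp)

theorem pderiv_y_hPoly (m k : ℕ) : pderiv (Sum.inr 0) (hPoly m k) = xProd m ^ 2 := by
  have hz : pderiv (Sum.inr 0) (zCoord m) = 0 := pderiv_X_of_ne (by simp)
  simp only [hPoly_eq, map_add, map_sub, Derivation.leibniz, Derivation.leibniz_pow, hz,
    pderiv_inr_xProd, pderiv_X_self, Derivation.map_one_eq_zero]
  simp

/-- The polynomial `2 + 2 k u (z² - 1)ᵏ⁻¹`, the cofactor of `z` in the derivative of `hPoly m k`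
with respect to `z`. -/
noncomputable def zFactor (m k : ℕ) : MvPolynomial (Fin m ⊕ Fin 2) ℂ :=
  2 + 2 * k * xProd m * (zCoord m ^ 2 - 1) ^ (k - 1)

theorem pderiv_z_hPoly (m k : ℕ) :
    pderiv (Sum.inr 1) (hPoly m k) = zCoord m * zFactor m k := by
  have hy : pderiv (Sum.inr 1) (yCoord m) = 0 := pderiv_X_of_ne (by simp)
  simp only [hPoly_eq, map_add, map_sub, Derivation.leibniz, Derivation.leibniz_pow, hy,
    pderiv_inr_xProd, pderiv_X_self, Derivation.map_one_eq_zero, smul_eq_mul, nsmul_eq_mul,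
    zFactor]
  push_cast
  ring

/-- The derivation `u² ∂/∂z - (∂P/∂z) ∂/∂y` for `P = hPoly m k`, which kills the `xᵢ` and `P`. -/
noncomputable def stdDerivation (m k : ℕ) :
    Derivation ℂ (MvPolynomial (Fin m ⊕ Fin 2) ℂ) (MvPolynomial (Fin m ⊕ Fin 2) ℂ) :=
  xProd m ^ 2 • pderiv (Sum.inr 1) - (zCoord m * zFactor m k) • pderiv (Sum.inr 0)

theorem stdDerivation_apply (m k : ℕ) (f : MvPolynomial (Fin m ⊕ Fin 2) ℂ) :
    stdDerivation m k f = xProd m ^ 2 * pderiv (Sum.inr 1) f -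
      zCoord m * zFactor m k * pderiv (Sum.inr 0) f := rfl

theorem stdDerivation_hPoly (m k : ℕ) : stdDerivation m k (hPoly m k) = 0 := by
  rw [stdDerivation_apply, pderiv_z_hPoly, pderiv_y_hPoly]
  ring

theorem stdDerivation_X_inl (k : ℕ) (i : Fin m) : stdDerivation m k (X (Sum.inl i)) = 0 := by
  rw [stdDerivation_apply, pderiv_X_of_ne (by simp), pderiv_X_of_ne (by simp)]
  ring

theorem stdDerivation_xProd (m k : ℕ) : stdDerivation m k (xProd m) = 0 :=
  Derivation.apply_prod_eq_zero _ _ _ fun i _ => stdDerivation_X_inl k i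

theorem stdDerivation_xProd_sq (m k : ℕ) : stdDerivation m k (xProd m ^ 2) = 0 := by
  rw [Derivation.leibniz_pow, stdDerivation_xProd, smul_zero, smul_zero]

theorem stdDerivation_zCoord (m k : ℕ) : stdDerivation m k (zCoord m) = xProd m ^ 2 := by
  rw [stdDerivation_apply, pderiv_X_self, pderiv_X_of_ne (by simp)]
  ring

theorem stdDerivation_yCoord (m k : ℕ) :
    stdDerivation m k (yCoord m) = - (zCoord m * zFactor m k) := by
  rw [stdDerivation_apply, pderiv_X_self, pderiv_X_of_ne (by simp)]
  ring

theorem stdDerivation_isLocallyNilpotent (m k : ℕ) :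
    (stdDerivation m k).IsLocallyNilpotent := by
  have hu : xProd m ∈ (stdDerivation m k).nilSubalgebra := ⟨1, stdDerivation_xProd m k⟩
  have hz : zCoord m ∈ (stdDerivation m k).nilSubalgebra := by
    refine Derivation.mem_nilSubalgebra_of_apply_mem _ ?_
    rw [stdDerivation_zCoord]
    exact pow_mem hu 2
  refine isLocallyNilpotent_of_forall_X fun s => ?_
  rcases s with i | s
  · exact ⟨1, stdDerivation_X_inl k i⟩
  · fin_cases s
    · refine Derivation.mem_nilSubalgebra_of_apply_mem _ ?_
      change stdDerivation m k (yCoord m) ∈ _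
      rw [stdDerivation_yCoord, zFactor]
      exact neg_mem (mul_mem hz (add_mem (ofNat_mem _ 2) (mul_mem (mul_mem
        (mul_mem (ofNat_mem _ 2) (natCast_mem _ k)) hu) (pow_mem (sub_mem (pow_mem hz 2)
          (one_mem _)) _))))
    · exact hz

/-! ### The reflection `z ↦ -z` -/

/-- The involution that changes the sign of `z` and fixes the other coordinates. -/
noncomputable def zReflection (m : ℕ) :
    MvPolynomial (Fin m ⊕ Fin 2) ℂ →ₐ[ℂ] MvPolynomial (Fin m ⊕ Fin 2) ℂ :=
  aeval (Function.update X (Sum.inr 1) (-X (Sum.inr 1)))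

theorem zReflection_X_inl (i : Fin m) : zReflection m (X (Sum.inl i)) = X (Sum.inl i) := by
  simp [zReflection]

theorem zReflection_xProd : zReflection m (xProd m) = xProd m := by
  simp only [xProd, map_prod, zReflection_X_inl]

theorem zReflection_yCoord : zReflection m (yCoord m) = yCoord m := by
  simp [zReflection]

theorem zReflection_zCoord : zReflection m (zCoord m) = -zCoord m := by
  simp [zReflection]

theorem zReflection_zFactor (k : ℕ) : zReflection m (zFactor m k) = zFactor m k := by
  simp only [zFactor, map_add, map_mul, map_pow, map_sub, map_one, map_ofNat, map_natCast,
    zReflection_xProd, zReflection_zCoord, neg_sq]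

theorem zCoord_dvd_sub_zReflection (f : MvPolynomial (Fin m ⊕ Fin 2) ℂ) :
    zCoord m ∣ f - zReflection m f := by
  induction f using MvPolynomial.induction_on with
  | C a => simp [zReflection]
  | add p q hp hq =>
    rw [map_add, add_sub_add_comm]
    exact dvd_add hp hq
  | mul_X p s hp =>
    have hs : zCoord m ∣ X s - zReflection m (X s) := by
      rcases eq_or_ne s (Sum.inr 1) with rfl | h
      · rw [zReflection_zCoord, sub_neg_eq_add]
        exact dvd_add dvd_rfl dvd_rfl
      · simp [zReflection, h]
    have : p * X s - zReflection m (p * X s) = (p - zReflection m p) * X s +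
        zReflection m p * (X s - zReflection m (X s)) := by
      rw [map_mul]
      ring
    rw [this]
    exact dvd_add (hp.mul_right _) (hs.mul_left _)

theorem stdDerivation_zReflection (k : ℕ) (f : MvPolynomial (Fin m ⊕ Fin 2) ℂ) :
    stdDerivation m k (zReflection m f) = - zReflection m (stdDerivation m k f) := by
  induction f using MvPolynomial.induction_on with
  | C a =>
    have h : stdDerivation m k (C a) = 0 := (stdDerivation m k).map_algebraMap a
    have h' : zReflection m (C a) = C a := (zReflection m).commutes a
    rw [h', h, map_zero, neg_zero]
  | add p q hp hq =>
    simp only [map_add, hp, hq, neg_add]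
  | mul_X p s hp =>
    have hs : stdDerivation m k (zReflection m (X s)) =
        - zReflection m (stdDerivation m k (X s)) := by
      rcases s with i | s
      · rw [zReflection_X_inl, stdDerivation_X_inl, map_zero, neg_zero]
      · fin_cases s
        · change stdDerivation m k (zReflection m (yCoord m)) =
            - zReflection m (stdDerivation m k (yCoord m))
          rw [zReflection_yCoord, stdDerivation_yCoord, map_neg, map_mul, zReflection_zCoord,
            zReflection_zFactor]
          ring
        · change stdDerivation m k (zReflection m (zCoord m)) =
            - zReflection m (stdDerivation m k (zCoord m))
          rw [zReflection_zCoord, map_neg, stdDerivation_zCoord, map_pow, zReflection_xProd]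
    simp only [map_mul, Derivation.leibniz, smul_eq_mul, map_add, hp, hs]
    ring

/-- The kernel of the standard derivation is stable under `z ↦ -z` and factorially closed, and it
does not contain `z`; so it contains no nonzero odd element. -/
theorem zReflection_eq_of_stdDerivation_eq_zero {k : ℕ} {f : MvPolynomial (Fin m ⊕ Fin 2) ℂ}
    (hf : stdDerivation m k f = 0) : zReflection m f = f := by
  by_contra hne
  have h1 : stdDerivation m k (f - zReflection m f) = 0 := by
    rw [map_sub, stdDerivation_zReflection, hf, map_zero, neg_zero, sub_zero]
  have h2 := (stdDerivation_isLocallyNilpotent m k).eq_zero_of_dvd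
    (zCoord_dvd_sub_zReflection f) (sub_ne_zero.2 (Ne.symm hne)) h1
  rw [stdDerivation_zCoord] at h2
  exact pow_ne_zero 2 xProd_ne_zero h2

/-- If `f = D g` lies in the kernel of the standard derivation `D`, then so does `z f - u² g`.
This element and `f` are even in `z`, which gives `2 z f = u² (g - g(-z))`. -/
theorem xProd_sq_dvd_of_stdDerivation {k : ℕ} {f g : MvPolynomial (Fin m ⊕ Fin 2) ℂ}
    (hg : stdDerivation m k g = f) (hf : stdDerivation m k f = 0) : xProd m ^ 2 ∣ f := by
  have h1 : stdDerivation m k (zCoord m * f - xProd m ^ 2 * g) = 0 := by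
    simp only [map_sub, Derivation.leibniz, hf, hg, stdDerivation_zCoord, smul_eq_mul,
      stdDerivation_xProd_sq]
    ring
  have h2 := zReflection_eq_of_stdDerivation_eq_zero h1
  rw [map_sub, map_mul, map_mul, map_pow, zReflection_zCoord, zReflection_xProd,
    zReflection_eq_of_stdDerivation_eq_zero hf] at h2
  have h3 : xProd m ^ 2 ∣ zCoord m * f := by
    have h4 : zCoord m * f = xProd m ^ 2 * (C (1 / 2) * (g - zReflection m g)) := by
      have h5 : (2 : MvPolynomial (Fin m ⊕ Fin 2) ℂ) * C (1 / 2) = 1 := by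
        rw [← map_ofNat C 2, ← C_mul]
        simp
      linear_combination (-C (1 / 2)) * h2 - zCoord m * f * h5
    exact h4 ▸ dvd_mul_right _ _
  exact (isRelPrime_xProd_zCoord (m := m)).pow_left.dvd_of_dvd_mul_left h3

end StandardDerivation

/-! ### Automorphisms mapping one hypersurface to another -/

section Automorphism

open MvPolynomial

variable {m : ℕ}

/-- The transport of a derivation along an automorphism. -/
def Derivation.conj {R A : Type*} [CommRing R] [CommRing A] [Algebra R A]
    (φ : A ≃ₐ[R] A) (D : Derivation R A A) : Derivation R A A :=
  Derivation.mk' (φ.toLinearMap ∘ₗ D.toLinearMap ∘ₗ φ.symm.toLinearMap) fun a b => by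
    simp [Derivation.leibniz]

theorem Derivation.conj_apply_apply {R A : Type*} [CommRing R] [CommRing A] [Algebra R A]
    (φ : A ≃ₐ[R] A) (D : Derivation R A A) (a : A) : D.conj φ (φ a) = φ (D a) := by
  change φ (D (φ.symm (φ a))) = φ (D a)
  rw [AlgEquiv.symm_apply_apply]

theorem Derivation.IsLocallyNilpotent.conj {R A : Type*} [CommRing R] [CommRing A] [Algebra R A]
    (φ : A ≃ₐ[R] A) {D : Derivation R A A} (hD : D.IsLocallyNilpotent) :
    (D.conj φ).IsLocallyNilpotent := fun a => by
  obtain ⟨b, rfl⟩ := φ.surjective a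
  obtain ⟨n, hn⟩ := hD b
  refine ⟨n, ?_⟩
  have h : Function.Semiconj φ D (D.conj φ) := fun c => (D.conj_apply_apply φ c).symm
  rw [← h.iterate_right n b, hn, map_zero]

/-- The subalgebra generated by the `xᵢ` and `hPoly m k`, as the image of a polynomial ring. -/
noncomputable def kernelHom (m k : ℕ) :
    MvPolynomial (Option (Fin m)) ℂ →ₐ[ℂ] MvPolynomial (Fin m ⊕ Fin 2) ℂ :=
  aeval fun o => o.elim (hPoly m k) fun i => X (Sum.inl i)

/-- Setting `z = 0` turns `hPoly m k` into a polynomial of degree one in `y` over `ℂ[x]`. -/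
theorem kernelHom_injective (m k : ℕ) : Function.Injective (kernelHom m k) := by
  let u : MvPolynomial (Fin m) ℂ := ∏ i, X i
  let q : Polynomial (MvPolynomial (Fin m) ℂ) :=
    Polynomial.C (u ^ 2) * Polynomial.X + Polynomial.C (u * (-1) ^ k - 1)
  let κ : MvPolynomial (Fin m ⊕ Fin 2) ℂ →ₐ[ℂ] Polynomial (MvPolynomial (Fin m) ℂ) :=
    aeval (Sum.elim (fun i => Polynomial.C (X i)) ![Polynomial.X, 0])
  have hκ : κ.comp (kernelHom m k) =
      ((Polynomial.aeval q).restrictScalars ℂ).comp (optionEquivLeft ℂ (Fin m)).toAlgHom := by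
    refine algHom_ext fun o => ?_
    cases o with
    | none =>
      have h1 : κ (kernelHom m k (X none)) = q := by
        simp only [kernelHom, aeval_X, Option.elim, hPoly_eq, map_add, map_sub, map_mul, map_pow,
          map_prod, map_one, κ, Sum.elim_inl, Sum.elim_inr, q, u]
        simp
        ring
      simpa [optionEquivLeft_X_none] using h1
    | some i => simp [kernelHom, κ, optionEquivLeft_X_some]
  rw [injective_iff_map_eq_zero]
  intro p hp
  have h1 : (optionEquivLeft ℂ (Fin m) p).comp q = 0 := by
    have h2 := DFunLike.congr_fun hκ p
    rw [AlgHom.comp_apply, hp, map_zero] at h2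
    exact h2.symm
  rcases Polynomial.comp_eq_zero_iff.1 h1 with h | ⟨-, h⟩
  · exact (map_eq_zero_iff _ (optionEquivLeft ℂ (Fin m)).injective).1 h
  · have h2 : q.coeff 1 = 0 := by
      rw [h]
      exact Polynomial.coeff_C_succ
    rw [Polynomial.coeff_add, Polynomial.coeff_C_mul, Polynomial.coeff_X_one,
      Polynomial.coeff_C_succ, mul_one, add_zero] at h2
    exact absurd h2 (pow_ne_zero 2 (Finset.prod_ne_zero_iff.2 fun i _ => X_ne_zero i))

theorem stdDerivation_kernelHom (m k : ℕ) (p : MvPolynomial (Option (Fin m)) ℂ) :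
    stdDerivation m k (kernelHom m k p) = 0 := by
  induction p using MvPolynomial.induction_on with
  | C a =>
    have h : kernelHom m k (C a) = C a := (kernelHom m k).commutes a
    rw [h]
    exact (stdDerivation m k).map_algebraMap a
  | add p q hp hq => rw [map_add, map_add, hp, hq, add_zero]
  | mul_X p o hp =>
    have ho : stdDerivation m k (kernelHom m k (X o)) = 0 := by
      cases o with
      | none => simpa [kernelHom] using stdDerivation_hPoly m k
      | some i => simpa [kernelHom] using stdDerivation_X_inl k i
    rw [map_mul, Derivation.leibniz, hp, ho, smul_zero, smul_zero, add_zero]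

theorem not_X_inl_dvd_zFactor (k : ℕ) (i : Fin m) : ¬ X (Sum.inl i) ∣ zFactor m k := by
  intro h
  have h1 : (X (Sum.inl i) : MvPolynomial (Fin m ⊕ Fin 2) ℂ) ∣
      2 * k * xProd m * (zCoord m ^ 2 - 1) ^ (k - 1) :=
    ((Finset.dvd_prod_of_mem (fun j => X (Sum.inl j)) (Finset.mem_univ i)).mul_left _).mul_right _
  have h2 : (X (Sum.inl i) : MvPolynomial (Fin m ⊕ Fin 2) ℂ) ∣ 2 := (dvd_add_left h1).1 h
  obtain ⟨c, hc⟩ := h2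
  have h3 := congrArg constantCoeff hc
  rw [map_ofNat, map_mul, constantCoeff_X, zero_mul] at h3
  exact two_ne_zero h3

theorem isRelPrime_xProd_sq (k : ℕ) : IsRelPrime (xProd m ^ 2) (zCoord m * zFactor m k) := by
  have h : IsRelPrime (xProd m) (zCoord m * zFactor m k) := isRelPrime_xProd fun i h => by
    rcases X_prime.dvd_or_dvd h with h | h
    · simpa using X_dvd_X.1 h
    · exact not_X_inl_dvd_zFactor k i h
  exact h.pow_left

/-- A derivation that kills the `xᵢ` and `hPoly m l` is a multiple of the standard one, since
`u²` is prime to the derivative of `hPoly m l` with respect to `z`. -/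
theorem exists_eq_smul_stdDerivation
    {D : Derivation ℂ (MvPolynomial (Fin m ⊕ Fin 2) ℂ) (MvPolynomial (Fin m ⊕ Fin 2) ℂ)}
    (hx : ∀ i : Fin m, D (X (Sum.inl i)) = 0) {l : ℕ} (hP : D (hPoly m l) = 0) :
    ∃ h : MvPolynomial (Fin m ⊕ Fin 2) ℂ, D = h • stdDerivation m l := by
  have hD : D = D (zCoord m) • pderiv (Sum.inr 1) + D (yCoord m) • pderiv (Sum.inr 0) := by
    refine derivation_ext fun s => ?_
    simp only [Derivation.add_apply, Derivation.smul_apply, smul_eq_mul]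
    rcases s with i | s
    · rw [hx, pderiv_X_of_ne (by simp), pderiv_X_of_ne (by simp), mul_zero, mul_zero, add_zero]
    · fin_cases s
      · change D (yCoord m) = D (zCoord m) * pderiv (Sum.inr 1) (X (Sum.inr 0)) +
          D (yCoord m) * pderiv (Sum.inr 0) (X (Sum.inr 0))
        rw [pderiv_X_self, pderiv_X_of_ne (by simp), mul_one, mul_zero, zero_add]
      · change D (zCoord m) = D (zCoord m) * pderiv (Sum.inr 1) (X (Sum.inr 1)) +
          D (yCoord m) * pderiv (Sum.inr 0) (X (Sum.inr 1))
        rw [pderiv_X_self, pderiv_X_of_ne (by simp), mul_one, mul_zero, add_zero]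
  have h1 : D (zCoord m) * (zCoord m * zFactor m l) + D (yCoord m) * xProd m ^ 2 = 0 := by
    rw [hD, Derivation.add_apply, Derivation.smul_apply, Derivation.smul_apply, pderiv_z_hPoly,
      pderiv_y_hPoly] at hP
    exact hP
  obtain ⟨h, hh⟩ : xProd m ^ 2 ∣ D (zCoord m) := by
    refine (isRelPrime_xProd_sq (m := m) l).dvd_of_dvd_mul_right ?_
    rw [eq_neg_of_add_eq_zero_left h1, dvd_neg]
    exact dvd_mul_left _ _
  have hy : D (yCoord m) = - (h * (zCoord m * zFactor m l)) := by
    have hne : xProd m ^ 2 ≠ 0 := pow_ne_zero 2 xProd_ne_zero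
    refine mul_left_cancel₀ hne ?_
    rw [hh] at h1
    linear_combination h1
  refine ⟨h, ?_⟩
  rw [hD, hh, hy]
  refine Derivation.ext fun f => ?_
  simp only [Derivation.add_apply, Derivation.smul_apply, smul_eq_mul, stdDerivation_apply]
  ring

/-- An automorphism that maps `hPoly m k` to a multiple of `hPoly m l` carries the standard
derivation of the former to a multiple of the standard derivation of the latter. -/
theorem exists_conj_eq_smul
    (φ : MvPolynomial (Fin m ⊕ Fin 2) ℂ ≃ₐ[ℂ] MvPolynomial (Fin m ⊕ Fin 2) ℂ)
    {k l : ℕ} {c : ℂ} (hc : c ≠ 0) (hφ : φ (hPoly m k) = C c * hPoly m l) :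
    ∃ h : MvPolynomial (Fin m ⊕ Fin 2) ℂ, (stdDerivation m k).conj φ = h • stdDerivation m l := by
  have hP : (stdDerivation m k).conj φ (hPoly m l) = 0 := by
    have h1 := (stdDerivation m k).conj_apply_apply φ (hPoly m k)
    rw [hφ, stdDerivation_hPoly, map_zero, ← smul_eq_C_mul, Derivation.map_smul] at h1
    exact (smul_eq_zero.1 h1).resolve_left hc
  have h0 : (stdDerivation m k).conj φ ≠ 0 := fun h0 => by
    have h1 := (stdDerivation m k).conj_apply_apply φ (zCoord m)
    rw [h0, Derivation.zero_apply, stdDerivation_zCoord, eq_comm,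
      map_eq_zero_iff _ φ.injective] at h1
    exact pow_ne_zero 2 xProd_ne_zero h1
  refine exists_eq_smul_stdDerivation (fun i => ?_) hP
  refine apply_X_eq_zero ((stdDerivation_isLocallyNilpotent m k).conj φ) h0 hP
    (φ.toAlgHom.comp (kernelHom m k)) (φ.injective.comp (kernelHom_injective m k)) (fun p => ?_) i
  have h1 := (stdDerivation m k).conj_apply_apply φ (kernelHom m k p)
  rwa [stdDerivation_kernelHom, map_zero] at h1

/-- Here `φ(u)² = h Δ(φ(z))` for the standard derivation `Δ` of `hPoly m l`, and both factors on
the right lie in its kernel because the left-hand side does. -/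
theorem xProd_dvd_apply_xProd
    (φ : MvPolynomial (Fin m ⊕ Fin 2) ℂ ≃ₐ[ℂ] MvPolynomial (Fin m ⊕ Fin 2) ℂ)
    {k l : ℕ} {c : ℂ} (hc : c ≠ 0) (hφ : φ (hPoly m k) = C c * hPoly m l) :
    xProd m ∣ φ (xProd m) := by
  obtain ⟨h, hh⟩ := exists_conj_eq_smul φ hc hφ
  have hz : h * stdDerivation m l (φ (zCoord m)) = φ (xProd m) ^ 2 := by
    have h1 := (stdDerivation m k).conj_apply_apply φ (zCoord m)
    rwa [hh, stdDerivation_zCoord, map_pow] at h1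
  have hu : h * stdDerivation m l (φ (xProd m) ^ 2) = 0 := by
    have h1 := (stdDerivation m k).conj_apply_apply φ (xProd m ^ 2)
    rwa [hh, stdDerivation_xProd_sq, map_zero, map_pow] at h1
  have hne : φ (xProd m) ^ 2 ≠ 0 :=
    pow_ne_zero 2 ((map_ne_zero_iff _ φ.injective).2 xProd_ne_zero)
  have hu' := (mul_eq_zero.1 hu).resolve_left fun h0 => hne (by rw [← hz, h0, zero_mul])
  have h2 : xProd m ^ 2 ∣ stdDerivation m l (φ (zCoord m)) :=
    xProd_sq_dvd_of_stdDerivation rfl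
      ((stdDerivation_isLocallyNilpotent m l).eq_zero_of_dvd (Dvd.intro_left _ hz) hne hu')
  exact (IsIntegrallyClosed.pow_dvd_pow_iff two_ne_zero).1 (h2.trans (Dvd.intro_left _ hz))

/-- The product of the `xᵢ` is preserved up to a constant: the divisibility `u ∣ φ(u)` holds for
`φ` and for its inverse. -/
theorem exists_apply_xProd_eq
    (φ : MvPolynomial (Fin m ⊕ Fin 2) ℂ ≃ₐ[ℂ] MvPolynomial (Fin m ⊕ Fin 2) ℂ)
    {k l : ℕ} {c : ℂ} (hc : c ≠ 0) (hφ : φ (hPoly m k) = C c * hPoly m l) :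
    ∃ a : ℂ, a ≠ 0 ∧ φ (xProd m) = C a * xProd m := by
  have hφ' : φ.symm (hPoly m l) = C c⁻¹ * hPoly m k := by
    rw [AlgEquiv.symm_apply_eq, map_mul, hφ, ← mul_assoc]
    have h1 : φ (C c⁻¹) = C c⁻¹ := φ.commutes _
    rw [h1, ← C_mul, inv_mul_cancel₀ hc, C_1, one_mul]
  have h1 := xProd_dvd_apply_xProd φ hc hφ
  have h2 : φ (xProd m) ∣ xProd m := by
    have h3 := map_dvd φ (xProd_dvd_apply_xProd φ.symm (inv_ne_zero hc) hφ')
    rwa [AlgEquiv.apply_symm_apply] at h3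
  obtain ⟨w, hw⟩ := associated_of_dvd_dvd h1 h2
  obtain ⟨a, ha, haw⟩ := isUnit_iff_eq_C_of_isReduced.1 w.isUnit
  exact ⟨a, ha.ne_zero, by rw [← hw, haw, mul_comm]⟩

end Automorphism

/-! ### Inequivalence of the embeddings -/

section Inequivalence

open MvPolynomial

variable {m : ℕ}

/-- The polynomial `c z² + 1 - c` is a square only for `c = 1`. -/
theorem eq_one_of_sq_eq {f : MvPolynomial (Fin m ⊕ Fin 2) ℂ} {c : ℂ} (hc : c ≠ 0)
    (h : f ^ 2 - 1 = C c * (zCoord m ^ 2 - 1)) : c = 1 := by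
  let ψ : MvPolynomial (Fin m ⊕ Fin 2) ℂ →ₐ[ℂ] Polynomial ℂ :=
    aeval (Sum.elim (fun _ => 0) ![0, Polynomial.X])
  have hC : ψ (C c) = Polynomial.C c := ψ.commutes c
  have hz : ψ (zCoord m) = Polynomial.X := by simp [ψ]
  have h1 : ψ f ^ 2 = Polynomial.C c * Polynomial.X ^ 2 + Polynomial.C (1 - c) := by
    have h2 := congrArg ψ h
    simp only [map_sub, map_mul, map_pow, map_one, hC, hz] at h2
    rw [map_sub, map_one]
    linear_combination h2
  have hdeg : (ψ f).natDegree ≤ 1 := by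
    have h2 := congrArg Polynomial.natDegree h1
    rw [Polynomial.natDegree_pow, Polynomial.natDegree_add_C,
      Polynomial.natDegree_C_mul_X_pow 2 c hc] at h2
    omega
  obtain ⟨a, b, hab⟩ := Polynomial.exists_eq_X_add_C_of_natDegree_le_one hdeg
  rw [hab] at h1
  have e0 := congrArg (Polynomial.eval 0) h1
  have e1 := congrArg (Polynomial.eval 1) h1
  have e2 := congrArg (Polynomial.eval (-1)) h1
  simp only [Polynomial.eval_pow, Polynomial.eval_add, Polynomial.eval_mul, Polynomial.eval_C,
    Polynomial.eval_X] at e0 e1 e2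
  have h3 : a * b = 0 := by linear_combination (e1 - e2) / 4
  rcases mul_eq_zero.1 h3 with h4 | h4
  · refine absurd ?_ hc
    rw [h4] at e0 e1
    linear_combination e0 - e1
  · rw [h4] at e0
    linear_combination e0

/-- If `φ` maps `hPoly m 1` to `c * hPoly m 2`, then `φ(z) = ± z (1 + u (z² - 1) / 2)` modulo
`xᵢ²`, as one sees by comparing the terms of order at most one in `xᵢ`. -/
theorem exists_apply_zCoord_eq
    (φ : MvPolynomial (Fin m ⊕ Fin 2) ℂ ≃ₐ[ℂ] MvPolynomial (Fin m ⊕ Fin 2) ℂ)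
    {c a : ℂ} (hc : c ≠ 0) (ha : φ (xProd m) = C a * xProd m)
    (hφ : φ (hPoly m 1) = C c * hPoly m 2) (i : Fin m) :
    ∃ (e : ℂ) (v : MvPolynomial (Fin m ⊕ Fin 2) ℂ), e * e = 1 ∧ φ (zCoord m) =
      C e * zCoord m * (1 + C (1 / 2) * xProd m * (zCoord m ^ 2 - 1)) +
        X (Sum.inl i) ^ 2 * v := by
  classical
  set x : MvPolynomial (Fin m ⊕ Fin 2) ℂ := X (Sum.inl i) with hx
  set u' : MvPolynomial (Fin m ⊕ Fin 2) ℂ := ∏ j ∈ Finset.univ.erase i, X (Sum.inl j) with hu'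
  have hu : xProd m = x * u' := (Finset.mul_prod_erase _ _ (Finset.mem_univ i)).symm
  have hu0 : u' ≠ 0 := Finset.prod_ne_zero_iff.2 fun _ _ => X_ne_zero _
  have hx0 : x ≠ 0 := X_ne_zero _
  let ρ : MvPolynomial (Fin m ⊕ Fin 2) ℂ →ₐ[ℂ] MvPolynomial (Fin m ⊕ Fin 2) ℂ :=
    aeval (Function.update X (Sum.inl i) 0)
  have hρC : ∀ b : ℂ, ρ (C b) = C b := ρ.commutes
  have hρx : ρ x = 0 := by simp [ρ, hx]
  have hρz : ρ (zCoord m) = zCoord m := by simp [ρ]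
  have hρu : ρ u' = u' := by
    rw [hu', map_prod]
    refine Finset.prod_congr rfl fun j hj => ?_
    have hj' : (Sum.inl j : Fin m ⊕ Fin 2) ≠ Sum.inl i := fun h =>
      (Finset.mem_erase.1 hj).1 (Sum.inl_injective h)
    simp [ρ, Function.update_of_ne hj']
  let θ : MvPolynomial (Fin m ⊕ Fin 2) ℂ →ₐ[ℂ] MvPolynomial (Fin m ⊕ Fin 2) ℂ :=
    aeval (Function.update X (Sum.inr 1) 0)
  have hθC : ∀ b : ℂ, θ (C b) = C b := θ.commutes
  have hθz : θ (zCoord m) = 0 := by simp [θ]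
  have hθu : θ u' = u' := by
    rw [hu', map_prod]
    exact Finset.prod_congr rfl fun j hj => by simp [θ]
  set ζ := φ (zCoord m) with hζ
  have h1 : C a ^ 2 * (x * u') ^ 2 * φ (yCoord m) + ζ ^ 2 + C a * (x * u') * (ζ ^ 2 - 1) - 1 =
      C c * ((x * u') ^ 2 * yCoord m + zCoord m ^ 2 + (x * u') * (zCoord m ^ 2 - 1) ^ 2 - 1) := by
    rw [← hu, ← hPoly_eq m 2, ← hφ, hPoly_eq]
    simp only [map_add, map_sub, map_mul, map_pow, map_one, ha, ← hζ]
    ring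
  have h2 : ρ ζ ^ 2 - 1 = C c * (zCoord m ^ 2 - 1) := by
    have := congrArg ρ h1
    simp only [map_add, map_sub, map_mul, map_pow, map_one, hρx, hρz, hρC] at this
    linear_combination this
  obtain rfl := eq_one_of_sq_eq hc h2
  obtain ⟨e, he, hρζ⟩ : ∃ e : ℂ, e * e = 1 ∧ ρ ζ = C e * zCoord m := by
    have h3 : ρ ζ ^ 2 = zCoord m ^ 2 := by
      rw [C_1] at h2
      linear_combination h2
    rcases sq_eq_sq_iff_eq_or_eq_neg.1 h3 with h | h
    · exact ⟨1, by norm_num, by rw [h, C_1, one_mul]⟩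
    · exact ⟨-1, by norm_num, by rw [h, C_neg, C_1, neg_one_mul]⟩
  have hee : (C e : MvPolynomial (Fin m ⊕ Fin 2) ℂ) * C e = 1 := by rw [← C_mul, he, C_1]
  obtain ⟨w, hw⟩ := X_dvd_sub_aeval (Sum.inl i) ζ
  change ζ - ρ ζ = x * w at hw
  have hw' : ζ = C e * zCoord m + x * w := by rw [← hw, hρζ]; ring
  -- With `φ(z) = ± z + x w`, the terms of order one determine `w` modulo `x`.
  have h4 : C a ^ 2 * (x * u' ^ 2) * φ (yCoord m) + 2 * C e * zCoord m * w + x * w ^ 2 +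
      C a * u' * (ζ ^ 2 - 1) = x * u' ^ 2 * yCoord m + u' * (zCoord m ^ 2 - 1) ^ 2 := by
    refine mul_left_cancel₀ hx0 ?_
    rw [C_1] at h1
    have h5 : ζ ^ 2 = zCoord m ^ 2 + 2 * C e * zCoord m * x * w + x ^ 2 * w ^ 2 := by
      rw [hw']
      linear_combination zCoord m ^ 2 * hee
    linear_combination h1 - h5
  have h5 : 2 * C e * zCoord m * ρ w + C a * u' * (zCoord m ^ 2 - 1) =
      u' * (zCoord m ^ 2 - 1) ^ 2 := by
    have := congrArg ρ h4
    simp only [map_add, map_sub, map_mul, map_pow, map_one, map_ofNat, hρx, hρz, hρC, hρu,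
      hρζ] at this
    linear_combination this - C a * u' * zCoord m ^ 2 * hee
  have h6 : (C a : MvPolynomial (Fin m ⊕ Fin 2) ℂ) = -1 := by
    have := congrArg θ h5
    simp only [map_add, map_sub, map_mul, map_pow, map_one, map_ofNat, hθz, hθC, hθu] at this
    refine mul_right_cancel₀ hu0 ?_
    linear_combination -this
  have hhalf : (2 : MvPolynomial (Fin m ⊕ Fin 2) ℂ) * C (1 / 2) = 1 := by
    rw [← map_ofNat C 2, ← C_mul]
    simp
  have h7 : ρ w = C e * C (1 / 2) * u' * zCoord m * (zCoord m ^ 2 - 1) := by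
    have hz0 : zCoord m ≠ 0 := X_ne_zero _
    refine mul_left_cancel₀ hz0 ?_
    rw [h6] at h5
    linear_combination C e * C (1 / 2) * h5 - zCoord m * ρ w * (C e * C e * hhalf + hee)
  obtain ⟨v, hv⟩ := X_dvd_sub_aeval (Sum.inl i) w
  change w - ρ w = x * v at hv
  refine ⟨e, v, he, ?_⟩
  rw [hu]
  linear_combination hw' + x * hv + x * h7

/-- No automorphism maps `hPoly m 1` to a multiple of `hPoly m 2`. Such an automorphism would
carry the standard derivation of the former to `h` times the standard derivation of the latter;
evaluated on the image of `z`, divided by `xᵢ²` and restricted to `z = 0`, this makes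
`1 - u / 2` a unit modulo `xᵢ²`. -/
theorem not_apply_hPoly_eq (i : Fin m)
    (φ : MvPolynomial (Fin m ⊕ Fin 2) ℂ ≃ₐ[ℂ] MvPolynomial (Fin m ⊕ Fin 2) ℂ)
    {c : ℂ} (hc : c ≠ 0) : φ (hPoly m 1) ≠ C c * hPoly m 2 := by
  classical
  intro hφ
  obtain ⟨a, ha0, ha⟩ := exists_apply_xProd_eq φ hc hφ
  obtain ⟨h, hh⟩ := exists_conj_eq_smul φ hc hφ
  obtain ⟨e, v, he, hζ⟩ := exists_apply_zCoord_eq φ hc ha hφ i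
  set x : MvPolynomial (Fin m ⊕ Fin 2) ℂ := X (Sum.inl i) with hx
  set u' : MvPolynomial (Fin m ⊕ Fin 2) ℂ := ∏ j ∈ Finset.univ.erase i, X (Sum.inl j) with hu'
  have hu : xProd m = x * u' := (Finset.mul_prod_erase _ _ (Finset.mem_univ i)).symm
  have hu0 : u' ≠ 0 := Finset.prod_ne_zero_iff.2 fun _ _ => X_ne_zero _
  have hx0 : x ≠ 0 := X_ne_zero _
  have hdC : ∀ (s : Fin m ⊕ Fin 2) (b : ℂ), pderiv s (C b) = 0 := fun s b => pderiv_C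
  have hxs : ∀ s : Fin 2, pderiv (Sum.inr s) x = 0 := fun s => pderiv_X_of_ne (by simp)
  have hyz : pderiv (Sum.inr 0) (zCoord m) = 0 := pderiv_X_of_ne (by simp)
  have hzz : pderiv (Sum.inr 1) (zCoord m) = 1 := pderiv_X_self _
  have hy : pderiv (Sum.inr 0) (φ (zCoord m)) = x ^ 2 * pderiv (Sum.inr 0) v := by
    rw [hζ]
    simp only [map_add, map_sub, Derivation.leibniz, Derivation.leibniz_pow, hdC, hxs, hyz,
      pderiv_inr_xProd, Derivation.map_one_eq_zero, smul_eq_mul, nsmul_eq_mul]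
    ring
  have hz : pderiv (Sum.inr 1) (φ (zCoord m)) = C e * (1 + C (1 / 2) * xProd m *
      (3 * zCoord m ^ 2 - 1)) + x ^ 2 * pderiv (Sum.inr 1) v := by
    rw [hζ]
    simp only [map_add, map_sub, Derivation.leibniz, Derivation.leibniz_pow, hdC, hxs, hzz,
      pderiv_inr_xProd, Derivation.map_one_eq_zero, smul_eq_mul, nsmul_eq_mul]
    push_cast
    ring
  have h1 : h * (xProd m ^ 2 * pderiv (Sum.inr 1) (φ (zCoord m)) -
      zCoord m * zFactor m 2 * pderiv (Sum.inr 0) (φ (zCoord m))) = (C a * xProd m) ^ 2 := by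
    have h2 := (stdDerivation m 1).conj_apply_apply φ (zCoord m)
    rwa [hh, stdDerivation_zCoord, map_pow, ha, Derivation.smul_apply, stdDerivation_apply,
      smul_eq_mul] at h2
  rw [hy] at h1
  -- Since `∂φ(z)/∂y` is divisible by `x²`, so is the whole identity.
  have h2 : h * (u' ^ 2 * pderiv (Sum.inr 1) (φ (zCoord m)) -
      zCoord m * zFactor m 2 * pderiv (Sum.inr 0) v) = (C a * u') ^ 2 := by
    refine mul_left_cancel₀ (pow_ne_zero 2 hx0) ?_
    rw [hu] at h1
    linear_combination h1
  let θ : MvPolynomial (Fin m ⊕ Fin 2) ℂ →ₐ[ℂ] MvPolynomial (Fin m ⊕ Fin 2) ℂ :=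
    aeval (Function.update X (Sum.inr 1) 0)
  have hθC : ∀ b : ℂ, θ (C b) = C b := θ.commutes
  have hθx : θ x = x := by simp [θ, hx]
  have hθz : θ (zCoord m) = 0 := by simp [θ]
  have hθu : θ u' = u' := by
    rw [hu', map_prod]
    exact Finset.prod_congr rfl fun j hj => by simp [θ]
  set p := C e * (1 - C (1 / 2) * (x * u')) + x ^ 2 * θ (pderiv (Sum.inr 1) v) with hp
  have h3 : θ h * p = C a ^ 2 := by
    have h4 := congrArg θ h2
    rw [hz, hu] at h4
    simp only [map_add, map_sub, map_mul, map_pow, map_one, map_ofNat, hθz, hθC, hθu, hθx] at h4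
    refine mul_left_cancel₀ (pow_ne_zero 2 hu0) ?_
    rw [hp]
    linear_combination h4
  have hunit : IsUnit p := by
    refine isUnit_of_mul_isUnit_right (x := θ h) ?_
    rw [h3]
    exact ((isUnit_iff_ne_zero.2 ha0).map C).pow 2
  obtain ⟨b, -, hb⟩ := isUnit_iff_eq_C_of_isReduced.1 hunit
  -- A unit is constant, so it equals its value `e` at `xᵢ = 0`.
  have hbe : b = e := by
    have h4 := congrArg constantCoeff (hb.symm.trans hp)
    simpa [hx] using h4
  have h5 : x * θ (pderiv (Sum.inr 1) v) = C e * C (1 / 2) * u' := by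
    refine mul_left_cancel₀ hx0 ?_
    rw [hbe, hp] at hb
    linear_combination hb
  have h6 : x ∣ u' := by
    have hC : IsUnit (C e * C (1 / 2) : MvPolynomial (Fin m ⊕ Fin 2) ℂ) := by
      rw [← C_mul]
      refine (isUnit_iff_ne_zero.2 (mul_ne_zero ?_ (by norm_num))).map C
      rintro rfl
      simp at he
    exact hC.dvd_mul_left.1 (h5 ▸ dvd_mul_right _ _)
  obtain ⟨j, hj, hij⟩ := (Prime.dvd_finsetProd_iff X_prime _).1 h6
  have hij' := X_dvd_X.1 hij
  exact (Finset.mem_erase.1 hj).1 (Sum.inl_injective hij').symm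

end Inequivalence

/-! ### Irreducibility, smoothness and isomorphism of the hypersurfaces -/

section Hypersurfaces

open MvPolynomial

variable {m : ℕ}

theorem irreducible_hPoly (m k : ℕ) : Irreducible (hPoly m k) := by
  have h : hPoly m k = xProd m ^ 2 * X (Sum.inr 0) +
      (zCoord m ^ 2 - 1 + xProd m * (zCoord m ^ 2 - 1) ^ k) := by
    rw [hPoly_eq]
    ring
  have hx : xProd m ∈ supported ℂ ({Sum.inr 0}ᶜ : Set (Fin m ⊕ Fin 2)) :=
    prod_mem fun i _ => X_mem_supported.2 (by simp)
  have hz : zCoord m ∈ supported ℂ ({Sum.inr 0}ᶜ : Set (Fin m ⊕ Fin 2)) :=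
    X_mem_supported.2 (by simp)
  have hs := sub_mem (pow_mem hz 2) (one_mem _)
  rw [h]
  refine irreducible_mul_X_add _ _ _ (pow_ne_zero 2 xProd_ne_zero)
    (fun hv => (mem_supported.1 (pow_mem hx 2)) hv rfl)
    (fun hv => (mem_supported.1 (add_mem hs (mul_mem hx (pow_mem hs k)))) hv rfl) ?_
  refine IsRelPrime.pow_left (isRelPrime_xProd fun i hi => ?_)
  have h1 : (X (Sum.inl i) : MvPolynomial (Fin m ⊕ Fin 2) ℂ) ∣
      xProd m * (zCoord m ^ 2 - 1) ^ k :=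
    (Finset.dvd_prod_of_mem (fun j => X (Sum.inl j)) (Finset.mem_univ i)).mul_right _
  obtain ⟨c, hc⟩ := (dvd_add_left h1).1 hi
  have h2 := congrArg constantCoeff hc
  simp at h2

theorem isIntegral_hypersurface (m k : ℕ) :
    AlgebraicGeometry.IsIntegral (hypersurface (hPoly m k)).left := by
  have hp : Prime (hPoly m k) := (irreducible_hPoly m k).prime
  have : (Ideal.span {hPoly m k}).IsPrime := (Ideal.span_singleton_prime hp.ne_zero).2 hp
  change AlgebraicGeometry.IsIntegral (Spec (CommRingCat.of
    (MvPolynomial (Fin m ⊕ Fin 2) ℂ ⧸ Ideal.span {hPoly m k})))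
  infer_instance

/-- Isomorphic coordinate algebras give isomorphic affine schemes over `ℂ`. -/
theorem nonempty_over_iso {A B : Type} [CommRing A] [CommRing B] [Algebra ℂ A] [Algebra ℂ B]
    (e : A ≃ₐ[ℂ] B) :
    Nonempty ((Over.mk (Spec.map (CommRingCat.ofHom (algebraMap ℂ A))) : Over SpecC) ≅
      Over.mk (Spec.map (CommRingCat.ofHom (algebraMap ℂ B)))) := by
  refine ⟨Over.isoMk (Scheme.Spec.mapIso e.symm.toRingEquiv.toCommRingCatIso.op) ?_⟩
  change Spec.map (CommRingCat.ofHom e.symm.toRingEquiv.toRingHom) ≫ Spec.map _ = Spec.map _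
  rw [← Spec.map_comp, ← CommRingCat.ofHom_comp]
  congr 2
  exact RingHom.ext fun c => e.symm.commutes c

/-- Substitutions that are mutually inverse modulo the ideals `(f)` and `(g)`. -/
theorem nonempty_algEquiv_quotient {σ : Type} {f g : MvPolynomial σ ℂ}
    (α β : MvPolynomial σ ℂ →ₐ[ℂ] MvPolynomial σ ℂ) (hα : g ∣ α f) (hβ : f ∣ β g)
    (hβα : ∀ s, f ∣ β (α (X s)) - X s) (hαβ : ∀ s, g ∣ α (β (X s)) - X s) :
    Nonempty ((MvPolynomial σ ℂ ⧸ Ideal.span {f}) ≃ₐ[ℂ] (MvPolynomial σ ℂ ⧸ Ideal.span {g})) := by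
  let lift : ∀ {f g : MvPolynomial σ ℂ} (α : MvPolynomial σ ℂ →ₐ[ℂ] MvPolynomial σ ℂ)
      (_ : g ∣ α f),
      (MvPolynomial σ ℂ ⧸ Ideal.span {f}) →ₐ[ℂ] (MvPolynomial σ ℂ ⧸ Ideal.span {g}) :=
    fun {f g} α hα => Ideal.quotientMapₐ _ α (by
      rw [Ideal.span_singleton_le_iff_mem, Ideal.mem_comap, Ideal.mem_span_singleton]
      exact hα)
  refine ⟨AlgEquiv.ofAlgHom (lift α hα) (lift β hβ) ?_ ?_⟩
  · refine Ideal.Quotient.algHom_ext _ (algHom_ext fun s => ?_)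
    exact Ideal.Quotient.eq.2 (Ideal.mem_span_singleton.2 (hαβ s))
  · refine Ideal.Quotient.algHom_ext _ (algHom_ext fun s => ?_)
    exact Ideal.Quotient.eq.2 (Ideal.mem_span_singleton.2 (hβα s))

/-- The substitution of `p` for `y`. -/
noncomputable def substY (p : MvPolynomial (Fin m ⊕ Fin 2) ℂ) :
    MvPolynomial (Fin m ⊕ Fin 2) ℂ →ₐ[ℂ] MvPolynomial (Fin m ⊕ Fin 2) ℂ :=
  aeval (Function.update X (Sum.inr 0) p)

theorem substY_X_inl (p : MvPolynomial (Fin m ⊕ Fin 2) ℂ) (i : Fin m) :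
    substY p (X (Sum.inl i)) = X (Sum.inl i) := by simp [substY]

theorem substY_xProd (p : MvPolynomial (Fin m ⊕ Fin 2) ℂ) : substY p (xProd m) = xProd m := by
  simp only [xProd, map_prod, substY_X_inl]

theorem substY_yCoord (p : MvPolynomial (Fin m ⊕ Fin 2) ℂ) : substY p (yCoord m) = p := by
  simp [substY]

theorem substY_zCoord (p : MvPolynomial (Fin m ⊕ Fin 2) ℂ) :
    substY p (zCoord m) = zCoord m := by simp [substY]

/-- The hypersurfaces are all isomorphic to `u² y + z² = 1`: multiplication by
`1 ∓ u (z² - 1)ᵏ` removes or creates the term of order one in `u`. -/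
theorem nonempty_algEquiv_hPoly (m k : ℕ) :
    Nonempty ((MvPolynomial (Fin m ⊕ Fin 2) ℂ ⧸
        Ideal.span {xProd m ^ 2 * yCoord m + zCoord m ^ 2 - 1}) ≃ₐ[ℂ]
      (MvPolynomial (Fin m ⊕ Fin 2) ℂ ⧸ Ideal.span {hPoly m (k + 1)})) := by
  set s : MvPolynomial (Fin m ⊕ Fin 2) ℂ := zCoord m ^ 2 - 1 with hs
  set p : MvPolynomial (Fin m ⊕ Fin 2) ℂ :=
    yCoord m * (1 - xProd m * s ^ k) - (s ^ k) ^ 2 * s with hp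
  set q : MvPolynomial (Fin m ⊕ Fin 2) ℂ := yCoord m * (1 + xProd m * s ^ k) with hq
  have hsub : ∀ r : MvPolynomial (Fin m ⊕ Fin 2) ℂ, substY r s = s := fun r => by
    rw [hs, map_sub, map_pow, map_one, substY_zCoord]
  have hP : hPoly m (k + 1) = xProd m ^ 2 * yCoord m + s + xProd m * (s ^ k * s) := by
    rw [hPoly_eq, ← pow_succ, ← hs]
    linear_combination -hs
  refine nonempty_algEquiv_quotient (substY p) (substY q) ⟨1 - xProd m * s ^ k, ?_⟩
    ⟨1 + xProd m * s ^ k, ?_⟩ (fun t => ?_) (fun t => ?_)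
  · rw [add_sub_assoc, ← hs, map_add, map_mul, map_pow, substY_xProd, substY_yCoord, hsub, hP, hp]
    ring
  · rw [hP]
    simp only [map_add, map_mul, map_pow, substY_xProd, substY_yCoord, hsub]
    rw [hq]
    linear_combination (1 + xProd m * s ^ k) * hs
  · rcases t with i | t
    · simp [substY_X_inl]
    · fin_cases t
      · change _ ∣ substY q (substY p (yCoord m)) - yCoord m
        refine ⟨-(s ^ k) ^ 2, ?_⟩
        rw [substY_yCoord, hp]
        simp only [map_sub, map_mul, map_pow, map_one, substY_xProd, substY_yCoord, hsub]
        rw [hq]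
        linear_combination -(s ^ k) ^ 2 * hs
      · change _ ∣ substY q (substY p (zCoord m)) - zCoord m
        simp [substY_zCoord]
  · rcases t with i | t
    · simp [substY_X_inl]
    · fin_cases t
      · change _ ∣ substY p (substY q (yCoord m)) - yCoord m
        refine ⟨-(s ^ k) ^ 2, ?_⟩
        rw [substY_yCoord, hq]
        simp only [map_add, map_mul, map_pow, map_one, substY_xProd, substY_yCoord, hsub]
        rw [hp, hP]
        ring
      · change _ ∣ substY p (substY q (zCoord m)) - zCoord m
        simp [substY_zCoord]

/-- An infinitesimal lift with error `ε` is corrected by `y ↦ y - ε y`, `z ↦ z - ε z / 2`,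
because `u² y + z² = 1 + ε`. -/
theorem formallySmooth_quotient (m : ℕ) : Algebra.FormallySmooth ℂ
    (MvPolynomial (Fin m ⊕ Fin 2) ℂ ⧸
      Ideal.span {xProd m ^ 2 * yCoord m + zCoord m ^ 2 - 1}) := by
  refine Algebra.FormallySmooth.of_comp_surjective fun B _ _ I hI f => ?_
  choose b hb using fun t : Fin m ⊕ Fin 2 =>
    Ideal.Quotient.mk_surjective (I := I) (f (Ideal.Quotient.mk _ (X t)))
  set U : B := ∏ i : Fin m, b (Sum.inl i) with hU
  set ε : B := U ^ 2 * b (Sum.inr 0) + b (Sum.inr 1) ^ 2 - 1 with hε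
  have hεI : ε ∈ I := by
    rw [← Ideal.Quotient.eq_zero_iff_mem, hε, hU]
    simp only [map_sub, map_add, map_mul, map_pow, map_prod, map_one, hb]
    rw [← map_zero f, ← (Ideal.Quotient.eq_zero_iff_mem (I := Ideal.span
      {xProd m ^ 2 * yCoord m + zCoord m ^ 2 - 1})).2 (Ideal.mem_span_singleton_self _)]
    simp only [map_sub, map_add, map_mul, map_pow, map_prod, map_one]
  have hε2 : ε * ε = 0 := by
    rw [← Ideal.mem_bot, ← hI, pow_two]
    exact Ideal.mul_mem_mul hεI hεI
  set half : B := algebraMap ℂ B (1 / 2) with hhalf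
  have hh : 2 * half = 1 := by
    rw [hhalf, ← map_ofNat (algebraMap ℂ B) 2, ← map_mul]
    simp
  let b' : Fin m ⊕ Fin 2 → B := Sum.elim (fun i => b (Sum.inl i))
    ![b (Sum.inr 0) - ε * b (Sum.inr 0), b (Sum.inr 1) - ε * half * b (Sum.inr 1)]
  have hzero : aeval (R := ℂ) b' (xProd m ^ 2 * yCoord m + zCoord m ^ 2 - 1) = 0 := by
    simp only [map_sub, map_add, map_mul, map_pow, map_prod, map_one, aeval_X]
    change U ^ 2 * (b (Sum.inr 0) - ε * b (Sum.inr 0)) +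
      (b (Sum.inr 1) - ε * half * b (Sum.inr 1)) ^ 2 - 1 = 0
    linear_combination (-1 + ε) * hε + (half ^ 2 * b (Sum.inr 1) ^ 2 - 1) * hε2 -
      ε * b (Sum.inr 1) ^ 2 * hh
  refine ⟨Ideal.Quotient.liftₐ _ (aeval b') fun a ha => ?_, ?_⟩
  · obtain ⟨r, rfl⟩ := Ideal.mem_span_singleton.1 ha
    rw [map_mul, hzero, zero_mul]
  · refine Ideal.Quotient.algHom_ext _ (algHom_ext fun t => ?_)
    change Ideal.Quotient.mk I (aeval b' (X t)) = f (Ideal.Quotient.mk _ (X t))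
    rw [aeval_X, ← hb, Ideal.Quotient.eq]
    rcases t with i | t
    · simp [b']
    · fin_cases t
      · have : b' (Sum.inr 0) - b (Sum.inr 0) = ε * (-b (Sum.inr 0)) := by
          change b (Sum.inr 0) - ε * b (Sum.inr 0) - b (Sum.inr 0) = _
          ring
        exact this ▸ I.mul_mem_right _ hεI
      · have : b' (Sum.inr 1) - b (Sum.inr 1) = ε * (-half * b (Sum.inr 1)) := by
          change b (Sum.inr 1) - ε * half * b (Sum.inr 1) - b (Sum.inr 1) = _
          ring
        exact this ▸ I.mul_mem_right _ hεI

theorem smooth_hypersurface (m k : ℕ) : Smooth (hypersurface (hPoly m (k + 1))).hom := by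
  obtain ⟨e⟩ := nonempty_algEquiv_hPoly m k
  have h1 := formallySmooth_quotient m
  have h2 := Algebra.FormallySmooth.of_equiv e
  have h3 : Algebra.FinitePresentation ℂ
      (MvPolynomial (Fin m ⊕ Fin 2) ℂ ⧸ Ideal.span {hPoly m (k + 1)}) :=
    Algebra.FinitePresentation.quotient ⟨{hPoly m (k + 1)}, by simp⟩
  have h4 : Algebra.Smooth ℂ
      (MvPolynomial (Fin m ⊕ Fin 2) ℂ ⧸ Ideal.span {hPoly m (k + 1)}) := ⟨h2, h3⟩
  change Smooth (Spec.map _)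
  rw [HasRingHomProperty.Spec_iff (P := @Smooth)]
  exact RingHom.smooth_algebraMap.2 h4

end Hypersurfaces

/-! ### The complements -/

section Complements

open MvPolynomial

variable {m : ℕ}

/-- The complement of a hypersurface is the spectrum of the localization. -/
theorem nonempty_complement_iso {σ : Type} (f : MvPolynomial σ ℂ) :
    Nonempty (hypersurfaceComplement f ≅
      Over.mk (Spec.map (CommRingCat.ofHom (algebraMap ℂ (Localization.Away f))))) := by
  let U : (Spec (CommRingCat.of (MvPolynomial σ ℂ))).Opens :=
    ⟨(zeroSet f)ᶜ, (isClosed_zeroSet f).isOpen_compl⟩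
  let j : Spec (CommRingCat.of (Localization.Away f)) ⟶
      Spec (CommRingCat.of (MvPolynomial σ ℂ)) :=
    Spec.map (CommRingCat.ofHom (algebraMap (MvPolynomial σ ℂ) (Localization.Away f)))
  have hj : IsOpenImmersion j := by
    change IsOpenImmersion (Spec.map _)
    infer_instance
  have hrange : Set.range U.ι = Set.range j := by
    rw [Scheme.Opens.range_ι]
    exact (PrimeSpectrum.basicOpen_eq_zeroLocus_compl f).symm.trans
      (PrimeSpectrum.localization_away_comap_range (Localization.Away f) f).symm
  let iso : (U : Scheme) ≅ Spec (CommRingCat.of (Localization.Away f)) :=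
    IsOpenImmersion.isoOfRangeEq U.ι j hrange
  refine ⟨Over.isoMk iso ?_⟩
  have hfac : (Spec.map (CommRingCat.ofHom (algebraMap ℂ (Localization.Away f))) :
      Spec (CommRingCat.of (Localization.Away f)) ⟶ SpecC) = j ≫ (affineSpaceC σ).hom := by
    change _ = Spec.map _ ≫ Spec.map _
    rw [← Spec.map_comp, ← CommRingCat.ofHom_comp, ← IsScalarTower.algebraMap_eq]
  have hiso : iso.hom ≫ j = U.ι := IsOpenImmersion.isoOfRangeEq_hom_fac U.ι j hrange
  change iso.hom ≫ Spec.map _ = U.ι ≫ (affineSpaceC σ).hom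
  rw [hfac, ← hiso]
  exact (Category.assoc _ _ _).symm

/-- The point of the affine space over `A` with the same coordinates as the given one, except that
`xᵢ` is multiplied by `c` and `y` is replaced by `b`. -/
noncomputable def rescale {A : Type} [CommRing A] [Algebra ℂ A] (i : Fin m)
    (g : Fin m ⊕ Fin 2 → A) (c b : A) : MvPolynomial (Fin m ⊕ Fin 2) ℂ →ₐ[ℂ] A :=
  aeval (Sum.elim (fun j => if j = i then c * g (Sum.inl j) else g (Sum.inl j))
    ![b, g (Sum.inr 1)])

section Rescale

variable {A : Type} [CommRing A] [Algebra ℂ A] (i : Fin m) (g : Fin m ⊕ Fin 2 → A) (c b : A)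

theorem rescale_X_inl (j : Fin m) : rescale i g c b (X (Sum.inl j)) =
    if j = i then c * g (Sum.inl j) else g (Sum.inl j) := by simp [rescale]

theorem rescale_yCoord : rescale i g c b (yCoord m) = b := by simp [rescale]

theorem rescale_zCoord : rescale i g c b (zCoord m) = g (Sum.inr 1) := by simp [rescale]

theorem rescale_xProd :
    rescale i g c b (xProd m) = c * ∏ j : Fin m, g (Sum.inl j) := by
  rw [xProd, map_prod, ← Finset.mul_prod_erase _ _ (Finset.mem_univ i),
    ← Finset.mul_prod_erase _ _ (Finset.mem_univ i), rescale_X_inl, if_pos rfl, mul_assoc]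
  congr 2
  refine Finset.prod_congr rfl fun j hj => ?_
  rw [rescale_X_inl, if_neg (Finset.mem_erase.1 hj).1]

end Rescale

/-- Multiplying one of the `xᵢ` by the unit `t = hPoly m 2` turns the equation
`u² y + s + u s² = t` into one of the form `u² y' + s + u s = t`, where `s = z² - 1`, since
`s ≡ t` modulo `u`. -/
theorem nonempty_algEquiv_localization (i : Fin m) :
    Nonempty (Localization.Away (hPoly m 1) ≃ₐ[ℂ] Localization.Away (hPoly m 2)) := by
  let g₁ : Fin m ⊕ Fin 2 → Localization.Away (hPoly m 1) := fun t =>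
    algebraMap (MvPolynomial (Fin m ⊕ Fin 2) ℂ) _ (X t)
  let g₂ : Fin m ⊕ Fin 2 → Localization.Away (hPoly m 2) := fun t =>
    algebraMap (MvPolynomial (Fin m ⊕ Fin 2) ℂ) _ (X t)
  let u₁ := ∏ j : Fin m, g₁ (Sum.inl j)
  let u₂ := ∏ j : Fin m, g₂ (Sum.inl j)
  let y₁ := g₁ (Sum.inr 0)
  let y₂ := g₂ (Sum.inr 0)
  let s₁ := g₁ (Sum.inr 1) ^ 2 - 1
  let s₂ := g₂ (Sum.inr 1) ^ 2 - 1
  let t₁ := algebraMap _ (Localization.Away (hPoly m 1)) (hPoly m 1)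
  let t₂ := algebraMap _ (Localization.Away (hPoly m 2)) (hPoly m 2)
  let r₁ : Localization.Away (hPoly m 1) := IsLocalization.Away.invSelf (hPoly m 1)
  let r₂ : Localization.Away (hPoly m 2) := IsLocalization.Away.invSelf (hPoly m 2)
  have htr₁ : t₁ * r₁ = 1 := IsLocalization.Away.mul_invSelf _
  have htr₂ : t₂ * r₂ = 1 := IsLocalization.Away.mul_invSelf _
  have ht₁ : t₁ = u₁ ^ 2 * y₁ + s₁ + u₁ * s₁ := by
    simp only [t₁, hPoly_eq, map_add, map_sub, map_mul, map_pow, map_prod, map_one]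
    simp only [u₁, y₁, s₁, g₁]
    ring
  have ht₂ : t₂ = u₂ ^ 2 * y₂ + s₂ + u₂ * s₂ ^ 2 := by
    simp only [t₂, hPoly_eq, map_add, map_sub, map_mul, map_pow, map_prod, map_one]
    simp only [u₂, y₂, s₂, g₂]
    ring
  -- The value of `y` is forced by the requirement that `hPoly m 1` goes to `t₂`, and similarly
  -- for `β₀`.
  let α₀ := rescale i g₂ t₂ ((y₂ * (1 - u₂ * s₂) - s₂ ^ 3) * r₂ ^ 2)
  let β₀ := rescale i g₁ r₁ (t₁ * (t₁ * y₁ + u₁ * s₁ * y₁ + s₁ ^ 2))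
  have hα₀ : α₀ (hPoly m 1) = t₂ := by
    simp only [hPoly_eq, map_add, map_sub, map_mul, map_pow, map_one, α₀, rescale_xProd,
      rescale_yCoord, rescale_zCoord]
    change (t₂ * u₂) ^ 2 * ((y₂ * (1 - u₂ * s₂) - s₂ ^ 3) * r₂ ^ 2) + g₂ (Sum.inr 1) ^ 2 +
      t₂ * u₂ * s₂ ^ 1 - 1 = t₂
    have hs : g₂ (Sum.inr 1) ^ 2 = s₂ + 1 := by simp only [s₂]; ring
    linear_combination hs + u₂ ^ 2 * (y₂ * (1 - u₂ * s₂) - s₂ ^ 3) * (t₂ * r₂ + 1) * htr₂ +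
      (u₂ * s₂ - 1) * ht₂
  have hβ₀ : β₀ (hPoly m 2) = t₁ := by
    simp only [hPoly_eq, map_add, map_sub, map_mul, map_pow, map_one, β₀, rescale_xProd,
      rescale_yCoord, rescale_zCoord]
    change (r₁ * u₁) ^ 2 * (t₁ * (t₁ * y₁ + u₁ * s₁ * y₁ + s₁ ^ 2)) + g₁ (Sum.inr 1) ^ 2 +
      r₁ * u₁ * s₁ ^ 2 - 1 = t₁
    have hs : g₁ (Sum.inr 1) ^ 2 = s₁ + 1 := by simp only [s₁]; ring
    linear_combination hs + r₁ * u₁ ^ 2 * (t₁ * y₁ + u₁ * s₁ * y₁ + s₁ ^ 2) * htr₁ +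
      (t₁ - s₁) * htr₁ + (-r₁ * (t₁ + u₁ * s₁)) * ht₁
  let α : Localization.Away (hPoly m 1) →ₐ[ℂ] Localization.Away (hPoly m 2) :=
    IsLocalization.liftAlgHom (M := Submonoid.powers (hPoly m 1)) (f := α₀) (by
      rintro ⟨_, n, rfl⟩
      change IsUnit (α₀ (hPoly m 1 ^ n))
      rw [map_pow, hα₀]
      exact (IsUnit.of_mul_eq_one _ htr₂).pow n)
  let β : Localization.Away (hPoly m 2) →ₐ[ℂ] Localization.Away (hPoly m 1) :=
    IsLocalization.liftAlgHom (M := Submonoid.powers (hPoly m 2)) (f := β₀) (by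
      rintro ⟨_, n, rfl⟩
      change IsUnit (β₀ (hPoly m 2 ^ n))
      rw [map_pow, hβ₀]
      exact (IsUnit.of_mul_eq_one _ htr₁).pow n)
  have hα : ∀ p, α (algebraMap _ _ p) = α₀ p := fun p => IsLocalization.lift_eq _ p
  have hβ : ∀ p, β (algebraMap _ _ p) = β₀ p := fun p => IsLocalization.lift_eq _ p
  have hαt : α t₁ = t₂ := (hα _).trans hα₀
  have hβt : β t₂ = t₁ := (hβ _).trans hβ₀
  have hαr : α r₁ = r₂ := by
    have h1 := congrArg α htr₁
    rw [map_mul, hαt, map_one] at h1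
    linear_combination r₂ * h1 - α r₁ * htr₂
  have hβr : β r₂ = r₁ := by
    have h1 := congrArg β htr₂
    rw [map_mul, hβt, map_one] at h1
    linear_combination r₁ * h1 - β r₂ * htr₁
  have hαu : α u₁ = t₂ * u₂ := by
    rw [show u₁ = algebraMap _ _ (xProd m) from (map_prod _ _ _).symm, hα]
    exact rescale_xProd i g₂ _ _
  have hβu : β u₂ = r₁ * u₁ := by
    rw [show u₂ = algebraMap _ _ (xProd m) from (map_prod _ _ _).symm, hβ]
    exact rescale_xProd i g₁ _ _
  have hαy : α y₁ = (y₂ * (1 - u₂ * s₂) - s₂ ^ 3) * r₂ ^ 2 :=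
    (hα _).trans (rescale_yCoord i g₂ _ _)
  have hβy : β y₂ = t₁ * (t₁ * y₁ + u₁ * s₁ * y₁ + s₁ ^ 2) :=
    (hβ _).trans (rescale_yCoord i g₁ _ _)
  have hαz : α (g₁ (Sum.inr 1)) = g₂ (Sum.inr 1) := (hα _).trans (rescale_zCoord i g₂ _ _)
  have hβz : β (g₂ (Sum.inr 1)) = g₁ (Sum.inr 1) := (hβ _).trans (rescale_zCoord i g₁ _ _)
  have hαs : α s₁ = s₂ := by simp only [s₁, s₂, map_sub, map_pow, map_one, hαz]
  have hβs : β s₂ = s₁ := by simp only [s₁, s₂, map_sub, map_pow, map_one, hβz]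
  have hαx : ∀ j, α (g₁ (Sum.inl j)) = if j = i then t₂ * g₂ (Sum.inl j) else g₂ (Sum.inl j) :=
    fun j => (hα _).trans (rescale_X_inl i g₂ _ _ j)
  have hβx : ∀ j, β (g₂ (Sum.inl j)) = if j = i then r₁ * g₁ (Sum.inl j) else g₁ (Sum.inl j) :=
    fun j => (hβ _).trans (rescale_X_inl i g₁ _ _ j)
  refine ⟨AlgEquiv.ofAlgHom α β ?_ ?_⟩
  · refine IsLocalization.algHom_ext (Submonoid.powers (hPoly m 2)) (algHom_ext fun t => ?_)
    change α (β (g₂ t)) = g₂ t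
    rcases t with j | t
    · rw [hβx]
      split_ifs with h
      · rw [map_mul, hαr, hαx, if_pos h]
        linear_combination g₂ (Sum.inl j) * htr₂
      · rw [hαx, if_neg h]
    · fin_cases t
      · change α (β y₂) = y₂
        rw [hβy]
        simp only [map_mul, map_add, map_pow, hαt, hαy, hαu, hαs]
        linear_combination
          (y₂ * (1 - u₂ * s₂) - s₂ ^ 3) * (1 + u₂ * s₂) * (t₂ * r₂ + 1) * htr₂ + s₂ ^ 2 * ht₂
      · change α (β (g₂ (Sum.inr 1))) = g₂ (Sum.inr 1)
        rw [hβz, hαz]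
  · refine IsLocalization.algHom_ext (Submonoid.powers (hPoly m 1)) (algHom_ext fun t => ?_)
    change β (α (g₁ t)) = g₁ t
    rcases t with j | t
    · rw [hαx]
      split_ifs with h
      · rw [map_mul, hβt, hβx, if_pos h]
        linear_combination g₁ (Sum.inl j) * htr₁
      · rw [hβx, if_neg h]
    · fin_cases t
      · change β (α y₁) = y₁
        rw [hαy]
        simp only [map_mul, map_sub, map_pow, map_one, hβr, hβy, hβu, hβs]
        linear_combination
          -(t₁ * y₁ + u₁ * s₁ * y₁ + s₁ ^ 2) * u₁ * s₁ * r₁ ^ 2 * htr₁ + r₁ ^ 2 * s₁ ^ 2 * ht₁ +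
            y₁ * (t₁ * r₁ + 1) * htr₁
      · change β (α (g₁ (Sum.inr 1))) = g₁ (Sum.inr 1)
        rw [hαz, hβz]

end Complements

/-! ### Automorphisms of affine space -/

section AffineSpace

open MvPolynomial

/-- An automorphism of the affine space over `ℂ` comes from an automorphism of the polynomial
algebra. -/
theorem exists_algEquiv_of_iso {σ : Type} (φ : affineSpaceC σ ≅ affineSpaceC σ) :
    ∃ e : MvPolynomial σ ℂ ≃ₐ[ℂ] MvPolynomial σ ℂ,
      φ.hom.left = Spec.map (CommRingCat.ofHom e.toRingEquiv.toRingHom) := by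
  let f : ∀ ψ : affineSpaceC σ ⟶ affineSpaceC σ,
      CommRingCat.of (MvPolynomial σ ℂ) ⟶ CommRingCat.of (MvPolynomial σ ℂ) :=
    fun ψ => Spec.preimage ψ.left
  have hf : ∀ ψ, Spec.map (f ψ) = ψ.left := fun ψ => Spec.map_preimage _
  have hcomm : ∀ ψ (c : ℂ), (f ψ).hom (C c) = C c := by
    intro ψ c
    have h1 : Spec.map (CommRingCat.ofHom (algebraMap ℂ (MvPolynomial σ ℂ)) ≫ f ψ) =
        Spec.map (CommRingCat.ofHom (algebraMap ℂ (MvPolynomial σ ℂ))) := by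
      rw [Spec.map_comp, hf]
      exact Over.w ψ
    have h2 := Spec.map_injective h1
    exact congrArg (fun h => CommRingCat.Hom.hom h c) h2
  have hinv : ∀ ψ χ : affineSpaceC σ ⟶ affineSpaceC σ, ψ ≫ χ = 𝟙 _ →
      ∀ a, (f ψ).hom ((f χ).hom a) = a := by
    intro ψ χ h a
    have h1 : Spec.map (f χ ≫ f ψ) = Spec.map (𝟙 _) := by
      rw [Spec.map_comp, hf, hf, Spec.map_id]
      exact congrArg (fun h => h.left) h
    have h2 := Spec.map_injective h1
    exact congrArg (fun h => CommRingCat.Hom.hom h a) h2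
  let F : ∀ ψ : affineSpaceC σ ⟶ affineSpaceC σ, MvPolynomial σ ℂ →ₐ[ℂ] MvPolynomial σ ℂ :=
    fun ψ => { (f ψ).hom with commutes' := hcomm ψ }
  refine ⟨AlgEquiv.ofAlgHom (F φ.hom) (F φ.inv) (AlgHom.ext (hinv _ _ φ.hom_inv_id))
    (AlgHom.ext (hinv _ _ φ.inv_hom_id)), ?_⟩
  rw [← hf φ.hom]
  rfl

/-- The prime ideal `(f)` is a point of the zero set of `f`, so its image lies in the zero set of
`g`, which means that `f` divides the pullback of `g`. -/
theorem associated_of_image_zeroSet {σ : Type} {f g : MvPolynomial σ ℂ} (hf : Irreducible f)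
    (hg : Irreducible g) (e : MvPolynomial σ ℂ ≃ₐ[ℂ] MvPolynomial σ ℂ)
    (h : (Spec.map (CommRingCat.ofHom e.toRingEquiv.toRingHom) :
      (affineSpaceC σ).left ⟶ (affineSpaceC σ).left) '' zeroSet f = zeroSet g) :
    Associated f (e g) := by
  have hprime : (Ideal.span {f}).IsPrime := (Ideal.span_singleton_prime hf.ne_zero).2 hf.prime
  let p : PrimeSpectrum (MvPolynomial σ ℂ) := ⟨Ideal.span {f}, hprime⟩
  have hp : p ∈ zeroSet f := fun a ha => by
    rw [Set.mem_singleton_iff.1 ha]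
    exact Ideal.mem_span_singleton_self f
  have h1 := h ▸ Set.mem_image_of_mem _ hp
  have h2 : e g ∈ Ideal.span {f} := h1 (Set.mem_singleton g)
  exact hf.associated_of_dvd ((MulEquiv.irreducible_iff e).2 hg)
    (Ideal.mem_span_singleton.1 h2)

end AffineSpace

/-- The two hypersurfaces are smooth and irreducible (even integral), isomorphic over `ℂ`, have
isomorphic complements over `ℂ`, and no automorphism of the affine space maps one onto the
other. -/
theorem mainTheorem4 (m : ℕ) (hm : 1 ≤ m) :
    (Smooth (hypersurface (hPoly m 1)).hom ∧
      AlgebraicGeometry.IsIntegral (hypersurface (hPoly m 1)).left) ∧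
    (Smooth (hypersurface (hPoly m 2)).hom ∧
      AlgebraicGeometry.IsIntegral (hypersurface (hPoly m 2)).left) ∧
    Nonempty (hypersurface (hPoly m 1) ≅ hypersurface (hPoly m 2)) ∧
    Nonempty (hypersurfaceComplement (hPoly m 1) ≅ hypersurfaceComplement (hPoly m 2)) ∧
    ¬ ∃ φ : affineSpaceC (Fin m ⊕ Fin 2) ≅ affineSpaceC (Fin m ⊕ Fin 2),
      φ.hom.left '' zeroSet (hPoly m 1) = zeroSet (hPoly m 2) := by
  have i : Fin m := ⟨0, hm⟩
  refine ⟨⟨smooth_hypersurface m 0, isIntegral_hypersurface m 1⟩,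
    ⟨smooth_hypersurface m 1, isIntegral_hypersurface m 2⟩, ?_, ?_, ?_⟩
  · obtain ⟨e₁⟩ := nonempty_algEquiv_hPoly m 0
    obtain ⟨e₂⟩ := nonempty_algEquiv_hPoly m 1
    exact nonempty_over_iso (e₁.symm.trans e₂)
  · obtain ⟨c₁⟩ := nonempty_complement_iso (hPoly m 1)
    obtain ⟨c₂⟩ := nonempty_complement_iso (hPoly m 2)
    obtain ⟨e⟩ := nonempty_algEquiv_localization i
    obtain ⟨c⟩ := nonempty_over_iso e
    exact ⟨c₁ ≪≫ c ≪≫ c₂.symm⟩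
  · rintro ⟨φ, hφ⟩
    obtain ⟨e, he⟩ := exists_algEquiv_of_iso φ
    rw [he] at hφ
    obtain ⟨w, hw⟩ := associated_of_image_zeroSet (irreducible_hPoly m 1)
      (irreducible_hPoly m 2) e hφ
    obtain ⟨c, hc, hcw⟩ := MvPolynomial.isUnit_iff_eq_C_of_isReduced.1 w.isUnit
    have h1 : e.symm (hPoly m 1) * MvPolynomial.C c = hPoly m 2 := by
      have h2 := congrArg e.symm hw
      rw [map_mul, AlgEquiv.symm_apply_apply, hcw] at h2
      exact (congrArg _ (e.symm.commutes c)).symm.trans h2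
    refine not_apply_hPoly_eq i e.symm (inv_ne_zero hc.ne_zero) ?_
    rw [← h1, mul_left_comm, ← MvPolynomial.C_mul, inv_mul_cancel₀ hc.ne_zero,
      MvPolynomial.C_1, mul_one]
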